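/- Let $n$ be a non-negative integer and let $T_n$ be the semigroup of all upper triangular $n\times n$-matrices over the Boolean semiring $(\{0,1\},\max,\min)$ under matrix multiplication. A semigroup identity $\mathbf w\approx\mathbf w'$ is a formal pair of nonempty words over the variables $x_0,x_1,x_2,\dots$; it holds in $T_n$ if $\mathbf w$ and $\mathbf w'$ have the same value under every substitution of elements of $T_n$ for the variables. Then there is a polynomial-time algorithm which, given an arbitrary semigroup identity $\mathbf w\approx\mathbf w'$, decides whether it holds in $T_n$. Precisely, write the identity $\mathbf w\approx\mathbf w'$ over a finite alphabet by giving each variable $x_i$ as its index $i$ in binary followed by an end mark, and separating the two words by the sign $\approx$. For each fixed $n$ there are a multi-stack Turing machine and a polynomial $p$ such that, for every identity, the machine outputs whether the identity holds in $T_n$ within $p(\ell)$ steps, where $\ell$ is the length of the written input. Moreover, there is a polynomial $q$ such that the same machine answers within $q(m)$ steps on every identity whose variables are among $x_0,\dots,x_{m-1}$, where $m=|\mathbf w\mathbf w'|$ is the total length of the two words. (Every identity has this form after its variables are renamed.) -/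

import Mathlib

/-- The set `T_n` of upper triangular Boolean `n × n`-matrices
(`false` stands for `0` and `true` for `1`). -/
@[ext]
structure TriBoolMatrix (n : ℕ) where
  /-- the entries of the matrix -/
  entry : Fin n → Fin n → Bool
  /-- all entries below the main diagonal are `0` -/
  entry_eq_false : ∀ i j, j < i → entry i j = false

namespace TriBoolMatrix

/-- The matrix product over the Boolean semiring, in which addition is `max` and multiplication is
`min`: the `(i, j)` entry is `1` if and only if `A i k = B k j = 1` for some `k`. (The arithmetic
instances of Mathlib on `Bool` are not used: addition is exclusive or there.) -/
instance (n : ℕ) : Mul (TriBoolMatrix n) where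
  mul A B :=
    { entry := fun i j => decide (∃ k, A.entry i k = true ∧ B.entry k j = true)
      entry_eq_false := by
        intro i j hji
        rw [decide_eq_false_iff_not]
        rintro ⟨k, h1, h2⟩
        rcases lt_or_ge k i with hk | hk
        · simp [A.entry_eq_false i k hk] at h1
        · simp [B.entry_eq_false k j (lt_of_lt_of_le hji hk)] at h2 }

theorem mul_entry_eq_true {n : ℕ} (A B : TriBoolMatrix n) (i j : Fin n) :
    (A * B).entry i j = true ↔ ∃ k, A.entry i k = true ∧ B.entry k j = true :=
  decide_eq_true_iff

/-- The semigroup `(T_n, ·)`. -/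
instance (n : ℕ) : Semigroup (TriBoolMatrix n) where
  mul_assoc A B C := by
    ext i j
    rw [Bool.eq_iff_iff]
    simp only [mul_entry_eq_true]
    grind

end TriBoolMatrix

/-- A semigroup identity `w ≈ w'`: a formal pair of nonempty words over the variables
`x_0, x_1, x_2, …`, the variable `x_i` being represented by its index `i`. -/
structure SemigroupIdentity where
  /-- the left-hand word -/
  lhs : FreeSemigroup ℕ
  /-- the right-hand word -/
  rhs : FreeSemigroup ℕ

/-- The sequence of variables that makes up a word. -/
def wordLetters (w : FreeSemigroup ℕ) : List ℕ := w.head :: w.tail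

namespace SemigroupIdentity

/-- The identity `w ≈ w'` holds in the semigroup `S`: the two words take the same value under
every substitution of elements of `S` for the variables. -/
def HoldsIn (I : SemigroupIdentity) (S : Type*) [Semigroup S] : Prop :=
  ∀ φ : ℕ → S, FreeSemigroup.lift φ I.lhs = FreeSemigroup.lift φ I.rhs

/-- The size `|w w'|` of the identity `w ≈ w'`. -/
def size (I : SemigroupIdentity) : ℕ := I.lhs.length + I.rhs.length

/-- The variables of the identity, which has size `m`, are among `x_0, …, x_{m-1}`. Every identity
takes this form after its variables have been renamed. -/
def IsNormalized (I : SemigroupIdentity) : Prop :=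
  ∀ x ∈ wordLetters I.lhs ++ wordLetters I.rhs, x < I.size

end SemigroupIdentity

/-- The input alphabet of the machines: the binary digits, a mark that ends the index of a
variable, and the sign `≈`. -/
inductive InputSymbol where
  | bit (b : Bool)
  | endVar
  | approx
deriving DecidableEq, Fintype

/-- A word is written as the sequence of the indices of its variables, each of them in binary
(least significant digit first) and followed by the end mark. -/
def encodeWord (w : FreeSemigroup ℕ) : List InputSymbol :=
  (wordLetters w).flatMap fun x => x.bits.map InputSymbol.bit ++ [InputSymbol.endVar]

/-- The identity `w ≈ w'` as a machine input. -/
def encodeIdentity (I : SemigroupIdentity) : List InputSymbol :=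
  encodeWord I.lhs ++ InputSymbol.approx :: encodeWord I.rhs

open Classical in
/-- The identity checking problem of the semigroup `S`: the answer to the instance `I` is
`true` if `I` holds in `S`, and `false` otherwise. -/
noncomputable def checkId (S : Type*) [Semigroup S] (I : SemigroupIdentity) : Bool :=
  decide (I.HoldsIn S)

/-! View the matrices substituted for the variables as transition relations of a nondeterministic
automaton. The entry `(a, b)` of the value of a word is 1 exactly when a path labelled by the word
leads from `a` to `b` (`lift_entry_eq_true`). Triangularity makes the states weakly increasing along
a path, so with `k + 1` states a path makes at most `k` strict moves and is constant between them.
To carry a path from one word to another with the same ends, it suffices to choose `k` places in the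
second word so that each of its letters also occurs in the first word, in the same position relative
to the places of the strict moves (`Covers.exists_isPath`). Conversely, an automaton that counts the
marked places already passed forces such a choice (`covers_of_forall_isPath`). Hence the identity
holds in T_(k+1) if and only if `Covers k` holds in both directions (`holdsIn_succ_iff`).

For fixed `k`, `Covers k` is a statement of the form ∀p ∃p' ∀y ∃z about `2k + 2` positions, whose
atoms compare the order of two positions or the letters at them. Exhaustive search decides it: each
position is a mark on the tape, each quantifier a loop that moves a mark along the tape
(`PolyDecidable.exists`), and each atom takes a bounded number of passes. The nesting depth depends
only on `k`, so the time is polynomial, with a degree depending on n. The search is written as a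
structured program, which compiles to a Turing machine with the same step count (`Runs.steps`). On a
normalized identity of size m the input has length at most m(m + 1) + 1, which gives the second
bound. -/

/-! ### Structured stack programs and their compilation to multi-stack Turing machines -/

/-- Structured programs over finitely many stacks and a finite memory, the source language of the
compiler to Turing machines below. -/
inductive StackProgram {K : Type} (Γ : K → Type) (σ : Type) : Type
  | push (k : K) (f : σ → Γ k)
  | pop (k : K) (f : σ → Option (Γ k) → σ)
  | load (f : σ → σ)
  | seq (p q : StackProgram Γ σ)
  | ite (c : σ → Bool) (p q : StackProgram Γ σ)
  | loop (c : σ → Bool) (p : StackProgram Γ σ)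

namespace StackProgram

variable {K : Type} [DecidableEq K] {Γ : K → Type} {σ : Type}

/-- `Runs p v S v' S' t`: started with memory `v` and stacks `S`, the program `p` terminates after
exactly `t` steps with memory `v'` and stacks `S'`. -/
inductive Runs : StackProgram Γ σ → σ → (∀ k, List (Γ k)) → σ → (∀ k, List (Γ k)) → ℕ → Prop
  | push (k f v S) : Runs (.push k f) v S v (Function.update S k (f v :: S k)) 1
  | pop (k f v S) : Runs (.pop k f) v S (f v (S k).head?) (Function.update S k (S k).tail) 1
  | load (f v S) : Runs (.load f) v S (f v) S 1
  | seq {p q v S v' S' v'' S'' t t'} : Runs p v S v' S' t → Runs q v' S' v'' S'' t' →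
      Runs (.seq p q) v S v'' S'' (t + t')
  | ite_true {c p q v S v' S' t} : c v = true → Runs p v S v' S' t →
      Runs (.ite c p q) v S v' S' (1 + t)
  | ite_false {c p q v S v' S' t} : c v = false → Runs q v S v' S' t →
      Runs (.ite c p q) v S v' S' (1 + t)
  | loop_done {c p v S} : c v = false → Runs (.loop c p) v S v S 1
  | loop_step {c p v S v' S' v'' S'' t t'} : c v = true → Runs p v S v' S' t →
      Runs (.loop c p) v' S' v'' S'' t' → Runs (.loop c p) v S v'' S'' (1 + t + t')

/-- The labels of the Turing machine compiled from a program. -/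
def Label : StackProgram Γ σ → Type
  | push _ _ => Unit
  | pop _ _ => Unit
  | load _ => Unit
  | seq p q => Label p ⊕ Label q
  | ite _ p q => Option (Label p ⊕ Label q)
  | loop _ p => Option (Label p)

noncomputable instance Label.fintype : (p : StackProgram Γ σ) → Fintype (Label p)
  | push _ _ => inferInstanceAs (Fintype Unit)
  | pop _ _ => inferInstanceAs (Fintype Unit)
  | load _ => inferInstanceAs (Fintype Unit)
  | seq p q =>
    letI := Label.fintype p
    letI := Label.fintype q
    inferInstanceAs (Fintype (Label p ⊕ Label q))
  | ite _ p q =>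
    letI := Label.fintype p
    letI := Label.fintype q
    inferInstanceAs (Fintype (Option (Label p ⊕ Label q)))
  | loop _ p =>
    letI := Label.fintype p
    inferInstanceAs (Fintype (Option (Label p)))

/-- The label at which the compiled program starts. -/
def entry : (p : StackProgram Γ σ) → Label p
  | push _ _ => ()
  | pop _ _ => ()
  | load _ => ()
  | seq p _ => Sum.inl (entry p)
  | ite _ _ _ => none
  | loop _ _ => none

/-- Jump to a label, or halt. -/
def jump {L : Type} : Option L → Turing.TM2.Stmt Γ L σ
  | none => .halt
  | some l => .goto fun _ => l

theorem stepAux_jump {L : Type} (e : Option L) (v : σ) (S : ∀ k, List (Γ k)) :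
    Turing.TM2.stepAux (jump e) v S = ⟨e, v, S⟩ := by
  cases e <;> rfl

/-- The compiled program, with its labels embedded by `g`, which ends with a jump to `e`. -/
def code {L : Type} : (p : StackProgram Γ σ) → (Label p → L) → Option L →
    Label p → Turing.TM2.Stmt Γ L σ
  | push k f, _, e, _ => .push k f (jump e)
  | pop k f, _, e, _ => .pop k f (jump e)
  | load f, _, e, _ => .load f (jump e)
  | seq p q, g, e, l => match l with
    | .inl a => code p (fun a => g (.inl a)) (some (g (.inr (entry q)))) a
    | .inr b => code q (fun b => g (.inr b)) e b
  | ite c p q, g, e, l => match l with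
    | none => .branch c (jump (some (g (some (.inl (entry p))))))
        (jump (some (g (some (.inr (entry q))))))
    | some (.inl a) => code p (fun a => g (some (.inl a))) e a
    | some (.inr b) => code q (fun b => g (some (.inr b))) e b
  | loop c p, g, e, l => match l with
    | none => .branch c (jump (some (g (some (entry p))))) (jump e)
    | some a => code p (fun a => g (some a)) (some (g none)) a

/-- Iterated steps of a Turing machine. -/
def Steps {L : Type} (m : L → Turing.TM2.Stmt Γ L σ) (a b : Turing.TM2.Cfg Γ L σ) (t : ℕ) : Prop :=
  (flip bind (Turing.TM2.step m))^[t] (some a) = some b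

theorem Steps.trans {L : Type} {m : L → Turing.TM2.Stmt Γ L σ} {a b c : Turing.TM2.Cfg Γ L σ}
    {t u : ℕ} (h : Steps m a b t) (h' : Steps m b c u) : Steps m a c (t + u) := by
  unfold Steps at *
  rw [Nat.add_comm, Function.iterate_add_apply, h, h']

theorem Steps.one {L : Type} {m : L → Turing.TM2.Stmt Γ L σ} {l : L} {v : σ}
    {S : ∀ k, List (Γ k)} {b : Turing.TM2.Cfg Γ L σ} (h : Turing.TM2.stepAux (m l) v S = b) :
    Steps m ⟨some l, v, S⟩ b 1 :=
  congrArg some h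

/-- The costs in `Runs` are chosen to be those of the machine: each basic instruction, together with
the jump after it, is a single machine statement, a test is one branching step, and sequencing is
free because the first part jumps directly to the entry of the second. The embedding `g` and the
exit `e` are arbitrary so that the induction applies to subprograms of a larger program. -/
theorem Runs.steps {L : Type} {m : L → Turing.TM2.Stmt Γ L σ} {p : StackProgram Γ σ} {v v' : σ}
    {S S' : ∀ k, List (Γ k)} {t : ℕ} (h : Runs p v S v' S' t) :
    ∀ (g : Label p → L) (e : Option L), (∀ l, m (g l) = code p g e l) →
      Steps m ⟨some (g (entry p)), v, S⟩ ⟨e, v', S'⟩ t := by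
  induction h with
  | push k f v S =>
    intro g e hm
    refine Steps.one ?_
    rw [hm]
    simp [code, stepAux_jump]
  | pop k f v S =>
    intro g e hm
    refine Steps.one ?_
    rw [hm]
    simp [code, stepAux_jump]
  | load f v S =>
    intro g e hm
    refine Steps.one ?_
    rw [hm]
    simp [code, stepAux_jump]
  | seq h1 h2 ih1 ih2 =>
    intro g e hm
    exact (ih1 (fun a => g (.inl a)) _ fun l => hm (.inl l)).trans
      (ih2 (fun b => g (.inr b)) e fun l => hm (.inr l))
  | ite_true hc h1 ih =>
    intro g e hm
    refine Steps.trans (Steps.one ?_) (ih (fun a => g (some (.inl a))) e fun l => hm (some (.inl l)))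
    rw [hm]
    simp [code, entry, hc, stepAux_jump]
  | ite_false hc h1 ih =>
    intro g e hm
    refine Steps.trans (Steps.one ?_) (ih (fun a => g (some (.inr a))) e fun l => hm (some (.inr l)))
    rw [hm]
    simp [code, entry, hc, stepAux_jump]
  | loop_done hc =>
    intro g e hm
    refine Steps.one ?_
    rw [hm]
    simp [code, entry, hc, stepAux_jump]
  | loop_step hc h1 h2 ih1 ih2 =>
    intro g e hm
    refine Steps.trans (Steps.trans (Steps.one ?_)
      (ih1 (fun a => g (some a)) _ fun l => hm (some l))) (ih2 g e hm)
    rw [hm]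
    simp [code, entry, hc, stepAux_jump]

/-- The program terminates with the given result within `T` steps. -/
def RunsIn (p : StackProgram Γ σ) (v : σ) (S : ∀ k, List (Γ k)) (v' : σ) (S' : ∀ k, List (Γ k))
    (T : ℕ) : Prop :=
  ∃ t ≤ T, Runs p v S v' S' t

section

variable {p q : StackProgram Γ σ} {c : σ → Bool} {v v' v'' : σ} {S S' S'' : ∀ k, List (Γ k)}
  {T T' U : ℕ}

theorem RunsIn.mono (h : RunsIn p v S v' S' T) (hT : T ≤ U) : RunsIn p v S v' S' U :=
  let ⟨t, ht, hr⟩ := h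
  ⟨t, ht.trans hT, hr⟩

theorem RunsIn.push (k : K) (f : σ → Γ k) (h : Function.update S k (f v :: S k) = S') :
    RunsIn (.push k f) v S v S' 1 :=
  ⟨1, le_rfl, h ▸ Runs.push k f v S⟩

theorem RunsIn.pop (k : K) (f : σ → Option (Γ k) → σ)
    (h : Function.update S k (S k).tail = S') :
    RunsIn (.pop k f) v S (f v (S k).head?) S' 1 :=
  ⟨1, le_rfl, h ▸ Runs.pop k f v S⟩

theorem RunsIn.load (f : σ → σ) : RunsIn (.load f) v S (f v) S 1 :=
  ⟨1, le_rfl, Runs.load f v S⟩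

theorem RunsIn.seq (h : RunsIn p v S v' S' T) (h' : RunsIn q v' S' v'' S'' T') :
    RunsIn (.seq p q) v S v'' S'' (T + T') :=
  let ⟨t, ht, hr⟩ := h
  let ⟨t', ht', hr'⟩ := h'
  ⟨t + t', Nat.add_le_add ht ht', hr.seq hr'⟩

theorem RunsIn.ite_true (hc : c v = true) (h : RunsIn p v S v' S' T) :
    RunsIn (.ite c p q) v S v' S' (1 + T) :=
  let ⟨t, ht, hr⟩ := h
  ⟨1 + t, Nat.add_le_add le_rfl ht, hr.ite_true hc⟩

theorem RunsIn.ite_false (hc : c v = false) (h : RunsIn q v S v' S' T) :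
    RunsIn (.ite c p q) v S v' S' (1 + T) :=
  let ⟨t, ht, hr⟩ := h
  ⟨1 + t, Nat.add_le_add le_rfl ht, hr.ite_false hc⟩

theorem RunsIn.loop_done (hc : c v = false) : RunsIn (.loop c p) v S v S 1 :=
  ⟨1, le_rfl, Runs.loop_done hc⟩

theorem RunsIn.loop_step (hc : c v = true) (h : RunsIn p v S v' S' T)
    (h' : RunsIn (.loop c p) v' S' v'' S'' T') : RunsIn (.loop c p) v S v'' S'' (1 + T + T') :=
  let ⟨t, ht, hr⟩ := h
  let ⟨t', ht', hr'⟩ := h'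
  ⟨1 + t + t', by omega, hr.loop_step hc hr'⟩

end

end StackProgram

/-! ### A combinatorial criterion for identities of triangular Boolean matrices -/

/-- Every tuple of `k` positions of `l` is matched by a tuple of positions of `l'` such that each
letter of `l'` also occurs in `l` at a place that has the same order relations to the tuple. -/
def Covers (k : ℕ) (l l' : List ℕ) : Prop :=
  ∀ p : Fin k → ℕ, (∀ i, p i < l.length) → ∃ p' : Fin k → ℕ, (∀ i, p' i < l'.length) ∧
    ∀ y < l'.length, ∃ z < l.length, l'[y]? = l[z]? ∧
      ∀ i, (p' i < y ↔ p i < z) ∧ (y < p' i ↔ z < p i)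

/-- The sequence `q` of states is a path labelled by the word `l` in the automaton `A`. -/
def IsPath {n : ℕ} (A : ℕ → Fin n → Fin n → Bool) (l : List ℕ) (q : ℕ → Fin n) : Prop :=
  ∀ t x, l[t]? = some x → A x (q t) (q (t + 1)) = true

theorem foldl_mul_entry {n : ℕ} (φ : ℕ → TriBoolMatrix n) (l : List ℕ) (M : TriBoolMatrix n)
    (a b : Fin n) :
    (l.foldl (fun N x => N * φ x) M).entry a b = true ↔
      ∃ q : ℕ → Fin n, M.entry a (q 0) = true ∧ q l.length = b ∧
        IsPath (fun x => (φ x).entry) l q := by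
  induction l generalizing M with
  | nil =>
    simp only [List.foldl_nil, List.length_nil]
    constructor
    · intro h
      exact ⟨fun _ => b, h, rfl, fun t x hx => by simp at hx⟩
    · rintro ⟨q, h, rfl, -⟩
      exact h
  | cons x l ih =>
    rw [List.foldl_cons, ih]
    constructor
    · rintro ⟨q, h, hb, hq⟩
      obtain ⟨c, h1, h2⟩ := (TriBoolMatrix.mul_entry_eq_true _ _ _ _).1 h
      -- The intermediate state `c` of the first product is put in front of the path.
      refine ⟨fun t => Nat.casesOn t c q, h1, hb, ?_⟩
      rintro (_ | t) y hy
      · simp only [List.getElem?_cons_zero, Option.some.injEq] at hy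
        subst hy
        exact h2
      · exact hq t y (by simpa using hy)
    · rintro ⟨q, h, hb, hq⟩
      refine ⟨fun t => q (t + 1), ?_, hb, fun t y hy => hq (t + 1) y (by simpa using hy)⟩
      exact (TriBoolMatrix.mul_entry_eq_true _ _ _ _).2 ⟨q 0, h, hq 0 x rfl⟩

theorem lift_entry_eq_true {n : ℕ} (φ : ℕ → TriBoolMatrix n) (w : FreeSemigroup ℕ) (a b : Fin n) :
    (FreeSemigroup.lift φ w).entry a b = true ↔
      ∃ q : ℕ → Fin n, q 0 = a ∧ q (wordLetters w).length = b ∧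
        IsPath (fun x => (φ x).entry) (wordLetters w) q := by
  have h : FreeSemigroup.lift φ w = w.tail.foldl (fun N x => N * φ x) (φ w.head) := rfl
  rw [h, foldl_mul_entry]
  constructor
  · rintro ⟨q, h, hb, hq⟩
    refine ⟨fun t => Nat.casesOn t a q, rfl, by simpa [wordLetters] using hb, ?_⟩
    rintro (_ | t) y hy
    · simp only [wordLetters, List.getElem?_cons_zero, Option.some.injEq] at hy
      subst hy
      exact h
    · exact hq t y (by simpa [wordLetters] using hy)
  · rintro ⟨q, rfl, hb, hq⟩
    exact ⟨fun t => q (t + 1), hq 0 _ rfl, hb,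
      fun t y hy => hq (t + 1) y (by simpa [wordLetters] using hy)⟩

theorem IsPath.monotone {n : ℕ} {A : ℕ → Fin n → Fin n → Bool} {l : List ℕ} {q : ℕ → Fin n}
    (hA : ∀ x i j, A x i j = true → i ≤ j) (hq : IsPath A l q) {s t : ℕ} (hst : s ≤ t)
    (ht : t ≤ l.length) : q s ≤ q t := by
  induction t, hst using Nat.le_induction with
  | base => exact le_rfl
  | succ t _ ih =>
    exact (ih (by omega)).trans (hA _ _ _ (hq t l[t] (List.getElem?_eq_getElem (by omega))))

theorem exists_crossing {n : ℕ} (q : ℕ → Fin n) (i : Fin n) (h0 : q 0 ≤ i) {m : ℕ} (hm : i < q m) :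
    ∃ t < m, q t ≤ i ∧ i < q (t + 1) := by
  induction m with
  | zero => exact absurd hm (not_lt.2 h0)
  | succ m ih =>
    rcases lt_or_ge i (q m) with h | h
    · obtain ⟨t, ht, h'⟩ := ih h
      exact ⟨t, by omega, h'⟩
    · exact ⟨m, by omega, h, hm⟩

/-- The state of a monotone path at a given time depends only on which of its strict moves are
already made. Marking these moves in `l` and transporting the marks to `l'` lets each letter of `l'`
imitate its partner in `l`. -/
theorem Covers.exists_isPath {k : ℕ} {l l' : List ℕ} (hc : Covers k l l') (hl : l ≠ [])
    (hl' : l' ≠ []) {A : ℕ → Fin (k + 1) → Fin (k + 1) → Bool}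
    (hA : ∀ x i j, A x i j = true → i ≤ j) {q : ℕ → Fin (k + 1)} (hq : IsPath A l q) :
    ∃ q' : ℕ → Fin (k + 1), q' 0 = q 0 ∧ q' l'.length = q l.length ∧ IsPath A l' q' := by
  have hl0 := List.length_pos_iff.2 hl
  have hl0' := List.length_pos_iff.2 hl'
  -- The place `p i` is the only step that crosses from states at most `i` to states above `i`. The
  -- default 0, when there is no such step, does no harm: a superfluous mark only refines the order
  -- information.
  have hp : ∀ i : Fin k, ∃ p < l.length, ∀ t < l.length, q t ≤ i.castSucc →
      i.castSucc < q (t + 1) → p = t := by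
    intro i
    by_cases h : ∃ t < l.length, q t ≤ i.castSucc ∧ i.castSucc < q (t + 1)
    · obtain ⟨t, ht, h1, h2⟩ := h
      refine ⟨t, ht, fun s hs h3 h4 => ?_⟩
      rcases lt_trichotomy t s with hts | rfl | hts
      · exact absurd (h2.trans_le ((hq.monotone hA (by omega : t + 1 ≤ s) hs.le).trans h3))
          (lt_irrefl _)
      · rfl
      · exact absurd (h4.trans_le ((hq.monotone hA (by omega : s + 1 ≤ t) ht.le).trans h1))
          (lt_irrefl _)
    · push Not at h
      exact ⟨0, hl0, fun t ht h1 h2 => absurd h2 (not_lt.2 (h t ht h1))⟩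
  choose p hpl hp using hp
  -- If no mark lies in the interval from `s` to `t - 1`, the path is constant there: a strict move
  -- out of the state `q t` would cross the threshold `q t` and so be marked.
  have key : ∀ s t, s ≤ t → t ≤ l.length → (∀ i, s ≤ p i ↔ t ≤ p i) → q s = q t := by
    intro s t hst ht h
    induction t, hst using Nat.le_induction with
    | base => rfl
    | succ t hst ih =>
      rw [ih (by omega) fun i => ⟨fun h' => by have := (h i).1 h'; omega, fun h' => by omega⟩]
      refine le_antisymm (hq.monotone hA (by omega) ht) (not_lt.1 fun hlt => ?_)
      have hi : (q t : ℕ) < k := by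
        have h1 : (q t : ℕ) < q (t + 1) := hlt
        have h2 := (q (t + 1)).isLt
        omega
      have := hp ⟨q t, hi⟩ t (by omega) le_rfl hlt
      have := (h ⟨q t, hi⟩).1
      omega
  have key' : ∀ s t, s ≤ l.length → t ≤ l.length → (∀ i, s ≤ p i ↔ t ≤ p i) → q s = q t := by
    intro s t hs ht h
    rcases le_total s t with hst | hst
    · exact key s t hst ht h
    · exact (key t s hst hs fun i => (h i).symm).symm
  obtain ⟨p', hp', h⟩ := hc p hpl
  choose! z hz using h
  -- Before reading the letter `y` the new path is in the state that `q` has before reading the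
  -- partner `z y`; after the last letter it is in the final state of `q`.
  refine ⟨fun t => if t < l'.length then q (z t) else q l.length, ?_, ?_, ?_⟩
  · simp only [hl0', if_true]
    obtain ⟨hz1, -, hz2⟩ := hz 0 hl0'
    refine key' _ _ hz1.le (by omega) fun i => ?_
    have := hz2 i
    omega
  · simp
  · intro y x hyx
    have hy := (List.getElem?_eq_some_iff.1 hyx).1
    obtain ⟨hz1, hz2, hz3⟩ := hz y hy
    have hA' := hq (z y) x (hz2 ▸ hyx)
    simp only [hy, if_true]
    split_ifs with hy1
    · obtain ⟨hz1', -, hz3'⟩ := hz (y + 1) hy1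
      -- The marks before `z (y + 1)` correspond to those before `y + 1`, that is, to those not
      -- after `y`, and hence to the marks before `z y + 1`.
      rw [key' (z (y + 1)) (z y + 1) hz1'.le hz1 fun i => ?_]
      · exact hA'
      · have := hz3 i
        have := hz3' i
        omega
    · rw [key' l.length (z y + 1) le_rfl hz1 fun i => ?_]
      · exact hA'
      · have := hz3 i
        have := hp' i
        have := hpl i
        omega

/-- The number of distinct positions before `t` in a tuple. -/
def countBefore {k : ℕ} (p : Fin k → ℕ) (t : ℕ) : ℕ :=
  ((Finset.univ.image p).filter (· < t)).card

section countBefore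

variable {k : ℕ} (p : Fin k → ℕ)

theorem countBefore_le (t : ℕ) : countBefore p t ≤ k :=
  (Finset.card_filter_le _ _).trans (Finset.card_image_le.trans (by simp))

theorem countBefore_mono {s t : ℕ} (h : s ≤ t) : countBefore p s ≤ countBefore p t :=
  Finset.card_le_card fun x hx => by
    simp only [Finset.mem_filter] at hx ⊢
    exact ⟨hx.1, hx.2.trans_le h⟩

theorem countBefore_zero : countBefore p 0 = 0 := by
  simp [countBefore]

theorem countBefore_lt (i : Fin k) : countBefore p (p i) < countBefore p (p i + 1) := by
  refine Finset.card_lt_card (Finset.ssubset_iff_subset_ne.2 ⟨fun x hx => ?_, fun h => ?_⟩)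
  · simp only [Finset.mem_filter] at hx ⊢
    exact ⟨hx.1, by omega⟩
  · have : p i ∈ (Finset.univ.image p).filter (· < p i + 1) := by simp
    rw [← h] at this
    simp at this

end countBefore

/-- Let the states count the marked positions passed, and let a letter allow exactly the state
changes seen at its occurrences in `l`. A path on `l'` with the same ends must cross the level of
each mark, and each of its steps copies a step at some `z` in `l`. Comparing levels by monotonicity
gives the order relations. -/
theorem covers_of_forall_isPath {k : ℕ} {l l' : List ℕ}
    (h : ∀ A : ℕ → Fin (k + 1) → Fin (k + 1) → Bool, (∀ x i j, A x i j = true → i ≤ j) →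
      ∀ q, IsPath A l q → ∃ q', q' 0 = q 0 ∧ q' l'.length = q l.length ∧ IsPath A l' q') :
    Covers k l l' := by
  intro p hp
  let d : ℕ → Fin (k + 1) := fun t => ⟨countBefore p t, Nat.lt_succ_of_le (countBefore_le p t)⟩
  have hd : ∀ {s t}, s ≤ t → d s ≤ d t := fun hst => countBefore_mono p hst
  have hdi : ∀ i, d (p i) < d (p i + 1) := fun i => countBefore_lt p i
  classical
  let A : ℕ → Fin (k + 1) → Fin (k + 1) → Bool :=
    fun x a b => decide (∃ z, l[z]? = some x ∧ a = d z ∧ b = d (z + 1))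
  have hA : ∀ x i j, A x i j = true → i ≤ j := by
    intro x i j hx
    obtain ⟨z, -, rfl, rfl⟩ := of_decide_eq_true hx
    exact hd (by omega)
  obtain ⟨q, hq0, hqm, hq⟩ := h A hA d fun t x hx => decide_eq_true ⟨t, hx, rfl, rfl⟩
  have hz : ∀ y < l'.length, ∃ z < l.length, l'[y]? = l[z]? ∧ q y = d z ∧ q (y + 1) = d (z + 1) := by
    intro y hy
    obtain ⟨z, hz, h1, h2⟩ := of_decide_eq_true (hq y l'[y] (List.getElem?_eq_getElem hy))
    exact ⟨z, (List.getElem?_eq_some_iff.1 hz).1, by rw [hz, List.getElem?_eq_getElem hy], h1, h2⟩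
  have hd0 : d 0 = 0 := Fin.ext (countBefore_zero p)
  -- The path `q` starts at level 0 and ends above `d (p i)`, so some step crosses this level; that
  -- step becomes `p' i`.
  have hp' : ∀ i, ∃ y < l'.length, q y ≤ d (p i) ∧ d (p i) < q (y + 1) := by
    intro i
    refine exists_crossing q (d (p i)) ?_ ?_
    · rw [hq0, hd0]
      exact Fin.zero_le _
    · rw [hqm]
      exact (hdi i).trans_le (hd (hp i))
  choose p' hp'l hp1 hp2 using hp'
  refine ⟨p', hp'l, fun y hy => ?_⟩
  obtain ⟨z, hzl, hzy, h1, h2⟩ := hz y hy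
  refine ⟨z, hzl, hzy, fun i => ⟨⟨fun hlt => ?_, fun hlt => ?_⟩, ⟨fun hlt => ?_, fun hlt => ?_⟩⟩⟩
  · by_contra hcon
    have h3 := hq.monotone hA (by omega : p' i + 1 ≤ y) hy.le
    rw [h1] at h3
    exact absurd ((hp2 i).trans_le (h3.trans (hd (not_lt.1 hcon)))) (lt_irrefl _)
  · by_contra hcon
    have h3 := hq.monotone hA (not_lt.1 hcon) (hp'l i).le
    rw [h1] at h3
    exact absurd (((hdi i).trans_le (hd hlt)).trans_le (h3.trans (hp1 i))) (lt_irrefl _)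
  · by_contra hcon
    have h3 := hq.monotone hA (by omega : y + 1 ≤ p' i) (hp'l i).le
    rw [h2] at h3
    exact absurd (((hdi i).trans_le (hd (by omega))).trans_le (h3.trans (hp1 i))) (lt_irrefl _)
  · by_contra hcon
    have h3 := hq.monotone hA (by omega : p' i + 1 ≤ y + 1) hy
    rw [h2] at h3
    exact absurd ((hp2 i).trans_le (h3.trans (hd (by omega)))) (lt_irrefl _)

theorem holdsIn_zero (I : SemigroupIdentity) : I.HoldsIn (TriBoolMatrix 0) :=
  fun _ => TriBoolMatrix.ext (funext fun i => i.elim0)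

/-- Two Boolean matrices are equal when each entry equal to 1 in one is 1 in the other; each
covering direction supplies one of the two implications. -/
theorem holdsIn_succ_iff (k : ℕ) (I : SemigroupIdentity) :
    I.HoldsIn (TriBoolMatrix (k + 1)) ↔
      Covers k (wordLetters I.lhs) (wordLetters I.rhs) ∧
        Covers k (wordLetters I.rhs) (wordLetters I.lhs) := by
  have tri : ∀ M : TriBoolMatrix (k + 1), ∀ i j, M.entry i j = true → i ≤ j := by
    intro M i j h
    by_contra hlt
    rw [M.entry_eq_false i j (not_le.1 hlt)] at h
    exact absurd h (by decide)
  have forward : ∀ w w' : FreeSemigroup ℕ,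
      (∀ φ : ℕ → TriBoolMatrix (k + 1), FreeSemigroup.lift φ w = FreeSemigroup.lift φ w') →
        Covers k (wordLetters w) (wordLetters w') := by
    intro w w' h
    refine covers_of_forall_isPath fun A hA q hq => ?_
    let φ : ℕ → TriBoolMatrix (k + 1) := fun x => ⟨A x, fun i j hji => by
      by_contra hne
      exact absurd (hA x i j (by simpa using hne)) (not_le.2 hji)⟩
    have := (lift_entry_eq_true φ w (q 0) (q (wordLetters w).length)).2 ⟨q, rfl, rfl, hq⟩
    rw [h φ, lift_entry_eq_true] at this
    exact this
  have backward : ∀ w w' : FreeSemigroup ℕ, Covers k (wordLetters w) (wordLetters w') →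
      ∀ (φ : ℕ → TriBoolMatrix (k + 1)) (i j), (FreeSemigroup.lift φ w).entry i j = true →
        (FreeSemigroup.lift φ w').entry i j = true := by
    intro w w' h φ i j hij
    rw [lift_entry_eq_true] at hij ⊢
    obtain ⟨q, rfl, rfl, hq⟩ := hij
    exact h.exists_isPath (List.cons_ne_nil _ _) (List.cons_ne_nil _ _) (fun x => tri (φ x)) hq
  constructor
  · exact fun h => ⟨forward _ _ h, forward _ _ fun φ => (h φ).symm⟩
  · rintro ⟨h1, h2⟩ φ
    ext i j
    rw [Bool.eq_iff_iff]
    exact ⟨backward _ _ h1 φ i j, backward _ _ h2 φ i j⟩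

/-! ### The stacks and the finite memory of the machine -/

/-- The tape symbols of the machine: an input symbol with a finite set of marks. -/
abbrev Cell (ι : Type) : Type := InputSymbol × (ι → Bool)

/-- The stacks of the machine. -/
inductive StackName
  | input | output | main | aux | left | right
deriving DecidableEq

instance : Fintype StackName :=
  ⟨{.input, .output, .main, .aux, .left, .right}, fun k => by cases k <;> decide⟩

/-- The alphabets of the stacks. -/
def StackName.Alphabet (ι : Type) : StackName → Type
  | input => InputSymbol
  | output => Bool
  | main => Cell ι
  | aux => Cell ι
  | left => Bool
  | right => Bool

/-- The finite memory of the machine. -/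
@[ext]
structure Memory (ι : Type) where
  /-- the result of the last test -/
  flag : Bool
  /-- state of a pass over the tape -/
  carry : Bool
  /-- second state of a pass over the tape -/
  carry' : Bool
  /-- the last cell read -/
  cell : Option (Cell ι)
  /-- the last bit read from the left stack -/
  bit : Option Bool
  /-- the last bit read from the right stack -/
  bit' : Option Bool

noncomputable instance (ι : Type) [Fintype ι] : Fintype (Memory ι) := by
  classical
  exact Fintype.ofInjective
    (fun v : Memory ι => (v.flag, v.carry, v.carry', v.cell, v.bit, v.bit')) fun v w h => by
      simp only [Prod.mk.injEq] at h
      exact Memory.ext h.1 h.2.1 h.2.2.1 h.2.2.2.1 h.2.2.2.2.1 h.2.2.2.2.2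

/-- The memory at the start. -/
def Memory.init (ι : Type) : Memory ι := ⟨false, false, false, none, none, none⟩

/-- The contents of all stacks. -/
def contents {ι : Type} (x : List InputSymbol) (o : List Bool) (m a : List (Cell ι))
    (l r : List Bool) : ∀ k, List (StackName.Alphabet ι k)
  | .input => x
  | .output => o
  | .main => m
  | .aux => a
  | .left => l
  | .right => r

section contents

variable {ι : Type} (x : List InputSymbol) (o : List Bool) (m a : List (Cell ι)) (l r : List Bool)

theorem update_contents_input (y : List InputSymbol) :
    Function.update (contents x o m a l r) .input y = contents y o m a l r := by
  funext k; cases k <;> rfl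

theorem update_contents_output (y : List Bool) :
    Function.update (contents x o m a l r) .output y = contents x y m a l r := by
  funext k; cases k <;> rfl

theorem update_contents_main (y : List (Cell ι)) :
    Function.update (contents x o m a l r) .main y = contents x o y a l r := by
  funext k; cases k <;> rfl

theorem update_contents_aux (y : List (Cell ι)) :
    Function.update (contents x o m a l r) .aux y = contents x o m y l r := by
  funext k; cases k <;> rfl

theorem update_contents_left (y : List Bool) :
    Function.update (contents x o m a l r) .left y = contents x o m a y r := by
  funext k; cases k <;> rfl

theorem update_contents_right (y : List Bool) :
    Function.update (contents x o m a l r) .right y = contents x o m a l y := by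
  funext k; cases k <;> rfl

end contents

/-- The programs of the machine. -/
abbrev MarkProgram (ι : Type) : Type := StackProgram (StackName.Alphabet ι) (Memory ι)

namespace MarkProgram

open StackProgram

variable {ι : Type}

section basic

variable {x : List InputSymbol} {o : List Bool} {m a : List (Cell ι)} {l r : List Bool}
  {v : Memory ι}

theorem runsIn_popInput (f : Memory ι → Option InputSymbol → Memory ι) :
    RunsIn (.pop (Γ := StackName.Alphabet ι) StackName.input f) v (contents x o m a l r)
      (f v x.head?) (contents x.tail o m a l r) 1 :=
  RunsIn.pop (Γ := StackName.Alphabet ι) StackName.input f (update_contents_input x o m a l r _)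

theorem runsIn_popMain (f : Memory ι → Option (Cell ι) → Memory ι) :
    RunsIn (.pop (Γ := StackName.Alphabet ι) StackName.main f) v (contents x o m a l r)
      (f v m.head?) (contents x o m.tail a l r) 1 :=
  RunsIn.pop (Γ := StackName.Alphabet ι) StackName.main f (update_contents_main x o m a l r _)

theorem runsIn_popAux (f : Memory ι → Option (Cell ι) → Memory ι) :
    RunsIn (.pop (Γ := StackName.Alphabet ι) StackName.aux f) v (contents x o m a l r)
      (f v a.head?) (contents x o m a.tail l r) 1 :=
  RunsIn.pop (Γ := StackName.Alphabet ι) StackName.aux f (update_contents_aux x o m a l r _)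

theorem runsIn_popLeft (f : Memory ι → Option Bool → Memory ι) :
    RunsIn (.pop (Γ := StackName.Alphabet ι) StackName.left f) v (contents x o m a l r)
      (f v l.head?) (contents x o m a l.tail r) 1 :=
  RunsIn.pop (Γ := StackName.Alphabet ι) StackName.left f (update_contents_left x o m a l r _)

theorem runsIn_popRight (f : Memory ι → Option Bool → Memory ι) :
    RunsIn (.pop (Γ := StackName.Alphabet ι) StackName.right f) v (contents x o m a l r)
      (f v r.head?) (contents x o m a l r.tail) 1 :=
  RunsIn.pop (Γ := StackName.Alphabet ι) StackName.right f (update_contents_right x o m a l r _)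

theorem runsIn_pushOutput (f : Memory ι → Bool) :
    RunsIn (.push (Γ := StackName.Alphabet ι) StackName.output f) v (contents x o m a l r)
      v (contents x (f v :: o) m a l r) 1 :=
  RunsIn.push (Γ := StackName.Alphabet ι) StackName.output f (update_contents_output x o m a l r _)

theorem runsIn_pushMain (f : Memory ι → Cell ι) :
    RunsIn (.push (Γ := StackName.Alphabet ι) StackName.main f) v (contents x o m a l r)
      v (contents x o (f v :: m) a l r) 1 :=
  RunsIn.push (Γ := StackName.Alphabet ι) StackName.main f (update_contents_main x o m a l r _)

theorem runsIn_pushAux (f : Memory ι → Cell ι) :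
    RunsIn (.push (Γ := StackName.Alphabet ι) StackName.aux f) v (contents x o m a l r)
      v (contents x o m (f v :: a) l r) 1 :=
  RunsIn.push (Γ := StackName.Alphabet ι) StackName.aux f (update_contents_aux x o m a l r _)

theorem runsIn_pushLeft (f : Memory ι → Bool) :
    RunsIn (.push (Γ := StackName.Alphabet ι) StackName.left f) v (contents x o m a l r)
      v (contents x o m a (f v :: l) r) 1 :=
  RunsIn.push (Γ := StackName.Alphabet ι) StackName.left f (update_contents_left x o m a l r _)

theorem runsIn_pushRight (f : Memory ι → Bool) :
    RunsIn (.push (Γ := StackName.Alphabet ι) StackName.right f) v (contents x o m a l r)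
      v (contents x o m a l (f v :: r)) 1 :=
  RunsIn.push (Γ := StackName.Alphabet ι) StackName.right f (update_contents_right x o m a l r _)

end basic

/-! ### Passes over the tape -/

/-- A letter-to-letter transducer with two bits of memory. -/
abbrev Transducer (ι : Type) : Type := Bool × Bool → Cell ι → (Bool × Bool) × Cell ι

/-- The final state and the output of a transducer. -/
def transduce (δ : Transducer ι) : Bool × Bool → List (Cell ι) → (Bool × Bool) × List (Cell ι)
  | q, [] => (q, [])
  | q, c :: m => ((transduce δ (δ q c).1 m).1, (δ q c).2 :: (transduce δ (δ q c).1 m).2)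

theorem length_transduce (δ : Transducer ι) (q : Bool × Bool) (m : List (Cell ι)) :
    (transduce δ q m).2.length = m.length := by
  induction m generalizing q with
  | nil => rfl
  | cons c m ih => simp [transduce, ih]

/-- Read a cell through a transducer. -/
def readCell (δ : Transducer ι) (v : Memory ι) : Option (Cell ι) → Memory ι
  | none => { v with cell := none }
  | some c => { v with
      flag := (δ (v.flag, v.carry) c).1.1
      carry := (δ (v.flag, v.carry) c).1.2
      cell := some (δ (v.flag, v.carry) c).2 }

/-- The last cell read. -/
def lastCell (v : Memory ι) : Cell ι := v.cell.getD (.approx, fun _ => false)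

/-- Move the main stack through a transducer to the auxiliary stack. -/
def scanRight (δ : Transducer ι) : MarkProgram ι :=
  .seq (.pop StackName.main (readCell δ))
    (.loop (fun v => v.cell.isSome)
      (.seq (.push StackName.aux lastCell) (.pop StackName.main (readCell δ))))

/-- The transducer that changes nothing. -/
def idTransducer : Transducer ι := fun q c => (q, c)

/-- Move the auxiliary stack back to the main stack. -/
def rewind : MarkProgram ι :=
  .seq (.pop StackName.aux (readCell idTransducer))
    (.loop (fun v => v.cell.isSome)
      (.seq (.push StackName.main lastCell) (.pop StackName.aux (readCell idTransducer))))

/-- Rewrite the main stack by a transducer. -/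
def scan (δ : Transducer ι) : MarkProgram ι := .seq (scanRight δ) rewind

section scan

variable (x : List InputSymbol) (o : List Bool) (m a : List (Cell ι)) (l r : List Bool)
  (v : Memory ι) (δ : Transducer ι)

theorem runsIn_scanRight : RunsIn (scanRight δ) v (contents x o m a l r)
    { v with
      flag := (transduce δ (v.flag, v.carry) m).1.1
      carry := (transduce δ (v.flag, v.carry) m).1.2
      cell := none }
    (contents x o [] ((transduce δ (v.flag, v.carry) m).2.reverse ++ a) l r)
    (3 * m.length + 2) := by
  -- The loop is entered with the head already popped into the memory, which is the form in which
  -- the induction hypothesis returns. A cell costs three steps: test, push and pop.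
  suffices h : RunsIn (.loop (fun v => v.cell.isSome)
      (.seq (.push StackName.aux lastCell) (.pop StackName.main (readCell δ))))
      (readCell δ v m.head?) (contents x o m.tail a l r)
      { v with
        flag := (transduce δ (v.flag, v.carry) m).1.1
        carry := (transduce δ (v.flag, v.carry) m).1.2
        cell := none }
      (contents x o [] ((transduce δ (v.flag, v.carry) m).2.reverse ++ a) l r)
      (3 * m.length + 1) from
    ((runsIn_popMain (readCell δ)).seq h).mono (by omega)
  induction m generalizing v a with
  | nil => exact RunsIn.loop_done rfl
  | cons c m ih =>
    have := ih ((δ (v.flag, v.carry) c).2 :: a) (readCell δ v (some c))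
    refine (RunsIn.loop_step rfl ((runsIn_pushAux lastCell).seq (runsIn_popMain (readCell δ)))
      (Eq.mp ?_ this)).mono (T := 1 + (1 + 1) + (3 * m.length + 1)) (by simp; omega)
    simp [transduce, readCell, lastCell]

theorem transduce_idTransducer (q : Bool × Bool) : transduce idTransducer q m = (q, m) := by
  induction m with
  | nil => rfl
  | cons c m ih => simp [transduce, idTransducer, ih]

theorem runsIn_rewind : RunsIn rewind v (contents x o m a l r) { v with cell := none }
    (contents x o (a.reverse ++ m) [] l r) (3 * a.length + 2) := by
  suffices h : RunsIn (.loop (fun v => v.cell.isSome)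
      (.seq (.push StackName.main lastCell) (.pop StackName.aux (readCell idTransducer))))
      (readCell idTransducer v a.head?) (contents x o m a.tail l r)
      { v with cell := none } (contents x o (a.reverse ++ m) [] l r) (3 * a.length + 1) from
    ((runsIn_popAux (readCell idTransducer)).seq h).mono (by omega)
  induction a generalizing v m with
  | nil => exact RunsIn.loop_done rfl
  | cons c a ih =>
    have := ih (c :: m) (readCell idTransducer v (some c))
    refine (RunsIn.loop_step rfl
      ((runsIn_pushMain lastCell).seq (runsIn_popAux (readCell idTransducer)))
      (Eq.mp ?_ this)).mono (T := 1 + (1 + 1) + (3 * a.length + 1)) (by simp; omega)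
    simp [readCell, lastCell, idTransducer]

theorem runsIn_scan : RunsIn (scan δ) v (contents x o m [] l r)
    { v with
      flag := (transduce δ (v.flag, v.carry) m).1.1
      carry := (transduce δ (v.flag, v.carry) m).1.2
      cell := none }
    (contents x o (transduce δ (v.flag, v.carry) m).2 [] l r)
    (6 * m.length + 4) := by
  have h := (runsIn_scanRight x o m [] l r v δ).seq (runsIn_rewind _ _ _ _ _ _ _)
  simp only [List.append_nil, List.reverse_reverse, List.length_reverse, length_transduce] at h
  exact h.mono (by omega)

theorem transduce_snd_of_forall (hδ : ∀ q c, (δ q c).2 = c) (q : Bool × Bool) :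
    (transduce δ q m).2 = m := by
  induction m generalizing q with
  | nil => rfl
  | cons c m ih => simp [transduce, hδ, ih]

end scan

/-! ### Marks on the tape -/

/-- The word `s` with the positions `o, o + 1, …`, in which the mark `i` is at position `u i`. -/
def tapeFrom (u : ι → ℕ) : ℕ → List InputSymbol → List (Cell ι)
  | _, [] => []
  | o, a :: s => (a, fun i => decide (u i = o)) :: tapeFrom u (o + 1) s

/-- The word `s` with the mark `i` at position `u i`, where positions are counted from `1`. -/
def tape (s : List InputSymbol) (u : ι → ℕ) : List (Cell ι) := tapeFrom u 1 s

theorem length_tapeFrom (u : ι → ℕ) (o : ℕ) (s : List InputSymbol) :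
    (tapeFrom u o s).length = s.length := by
  induction s generalizing o with
  | nil => rfl
  | cons a s ih => simp [tapeFrom, ih]

theorem length_tape (s : List InputSymbol) (u : ι → ℕ) : (tape s u).length = s.length :=
  length_tapeFrom u 1 s

/-- A mark whose position lies outside the word leaves no trace. Thus both 0 and any position beyond
the end stand for an absent mark. -/
theorem tapeFrom_congr {u u' : ι → ℕ} (o : ℕ) (s : List InputSymbol)
    (h : ∀ i p, o ≤ p → p < o + s.length → (u i = p ↔ u' i = p)) :
    tapeFrom u o s = tapeFrom u' o s := by
  induction s generalizing o with
  | nil => rfl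
  | cons a s ih =>
    simp only [tapeFrom, List.length_cons] at h ⊢
    rw [ih (o + 1) fun i p h1 h2 => h i p (by omega) (by omega)]
    simp [h _ o le_rfl (by omega)]

theorem tapeFrom_append (u : ι → ℕ) (o : ℕ) (s t : List InputSymbol) :
    tapeFrom u o (s ++ t) = tapeFrom u o s ++ tapeFrom u (o + s.length) t := by
  induction s generalizing o with
  | nil => rfl
  | cons a s ih => simp [tapeFrom, ih, Nat.add_assoc, Nat.add_comm 1]

section marks

variable [DecidableEq ι] (i j : ι) (u : ι → ℕ)

/-- Move the mark `i` one position to the right. -/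
def shiftMark : Transducer ι := fun q c => ((q.1, c.2 i), (c.1, Function.update c.2 i q.2))

/-- The second state bit remembers whether the previous cell bore the mark. If it is true at the
start, an absent mark enters at the first cell; if it is true at the end, the mark has left the
word. -/
theorem transduce_shiftMark (f : Bool) (o : ℕ) (s : List InputSymbol) :
    transduce (shiftMark i) (f, decide (u i + 1 = o)) (tapeFrom u o s) =
      ((f, decide (u i + 1 = o + s.length)), tapeFrom (Function.update u i (u i + 1)) o s) := by
  induction s generalizing o with
  | nil => rfl
  | cons a s ih =>
    have := ih (o + 1)
    have h1 : decide (u i + 1 = o + 1) = decide (u i = o) := by simp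
    rw [h1] at this
    simp only [tapeFrom, transduce, shiftMark] at this ⊢
    rw [this]
    refine Prod.ext (by simp; omega) ?_
    simp only [List.cons.injEq, and_true, Prod.mk.injEq, true_and]
    funext k
    by_cases hk : k = i
    · subst hk; simp
    · simp [hk]

/-- Remove the mark `i`. -/
def clearMark : Transducer ι := fun q c => (q, (c.1, Function.update c.2 i false))

theorem transduce_clearMark (q : Bool × Bool) (o : ℕ) (ho : 1 ≤ o) (s : List InputSymbol) :
    transduce (clearMark i) q (tapeFrom u o s) = (q, tapeFrom (Function.update u i 0) o s) := by
  induction s generalizing o with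
  | nil => rfl
  | cons a s ih =>
    have := ih (o + 1) (by omega)
    simp only [tapeFrom, transduce, clearMark] at this ⊢
    rw [this]
    refine Prod.ext rfl ?_
    simp only [List.cons.injEq, and_true, Prod.mk.injEq, true_and]
    funext k
    by_cases hk : k = i
    · subst hk; simp; omega
    · simp [hk]

end marks

end MarkProgram

/-! ### Relations between words and marks decidable in polynomial time -/

namespace MarkProgram

open StackProgram

variable {ι : Type}

/-- The program `prog` decides the relation `P` between words and marks within `T` steps, provided
that the marks in `B`, which it may use for its own purposes, are absent at the start. -/
def DecidesIn (prog : MarkProgram ι) (B : Set ι) (P : List InputSymbol → (ι → ℕ) → Prop)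
    (T : Polynomial ℕ) : Prop :=
  ∀ s u, (∀ i, u i ≤ s.length) → (∀ i ∈ B, u i = 0) → ∀ v, ∃ v',
    RunsIn prog v (contents [] [] (tape s u) [] [] []) v' (contents [] [] (tape s u) [] [] [])
      (T.eval s.length) ∧ (v'.flag = true ↔ P s u)

/-- The relation `P` between words and marks is decidable in polynomial time, provided that the
marks in `B` are absent at the start. -/
def PolyDecidable (B : Set ι) (P : List InputSymbol → (ι → ℕ) → Prop) : Prop :=
  ∃ prog T, DecidesIn prog B P T

variable {B C : Set ι} {P Q : List InputSymbol → (ι → ℕ) → Prop}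

theorem PolyDecidable.congr (h : PolyDecidable B P)
    (hPQ : ∀ s u, (∀ i, u i ≤ s.length) → (∀ i ∈ B, u i = 0) → (P s u ↔ Q s u)) :
    PolyDecidable B Q := by
  obtain ⟨p, T, h⟩ := h
  refine ⟨p, T, fun s u hu hB v => ?_⟩
  obtain ⟨v', h1, h2⟩ := h s u hu hB v
  exact ⟨v', h1, h2.trans (hPQ s u hu hB)⟩

theorem PolyDecidable.mono (h : PolyDecidable B P) (hBC : B ⊆ C) : PolyDecidable C P := by
  obtain ⟨p, T, h⟩ := h
  exact ⟨p, T, fun s u hu hC => h s u hu fun i hi => hC i (hBC hi)⟩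

theorem PolyDecidable.trivial : PolyDecidable B fun _ _ => True := by
  refine ⟨.load fun v => { v with flag := true }, 1, fun s u _ _ v =>
    ⟨{ v with flag := true }, ?_, ?_⟩⟩
  · exact (RunsIn.load _).mono (by simp)
  · simp

theorem PolyDecidable.not (h : PolyDecidable B P) : PolyDecidable B fun s u => ¬ P s u := by
  obtain ⟨p, T, h⟩ := h
  refine ⟨.seq p (.load fun v => { v with flag := !v.flag }), T + 1, fun s u hu hB v => ?_⟩
  obtain ⟨v', h1, h2⟩ := h s u hu hB v
  refine ⟨_, (h1.seq (RunsIn.load _)).mono (by simp), ?_⟩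
  simp [← h2]

theorem PolyDecidable.and (h : PolyDecidable B P) (h' : PolyDecidable B Q) :
    PolyDecidable B fun s u => P s u ∧ Q s u := by
  obtain ⟨p, T, h⟩ := h
  obtain ⟨q, T', h'⟩ := h'
  refine ⟨.seq p (.ite (fun v => v.flag) q (.load id)), T + T' + 2, fun s u hu hB v => ?_⟩
  obtain ⟨v', h1, h2⟩ := h s u hu hB v
  cases hf : v'.flag with
  | true =>
    obtain ⟨v'', h3, h4⟩ := h' s u hu hB v'
    refine ⟨v'', (h1.seq (RunsIn.ite_true hf h3)).mono (by simp; omega), ?_⟩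
    show _ ↔ P s u ∧ Q s u
    rw [h4, ← h2]
    simp [hf]
  | false =>
    refine ⟨v', (h1.seq (RunsIn.ite_false hf (RunsIn.load _))).mono (by simp), ?_⟩
    show _ ↔ P s u ∧ Q s u
    rw [← h2]
    simp [hf]

theorem PolyDecidable.imp (h : PolyDecidable B P) (h' : PolyDecidable B Q) :
    PolyDecidable B fun s u => P s u → Q s u :=
  (h.and h'.not).not.congr fun s u _ _ => by tauto

theorem PolyDecidable.iff (h : PolyDecidable B P) (h' : PolyDecidable B Q) :
    PolyDecidable B fun s u => P s u ↔ Q s u :=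
  ((h.imp h').and (h'.imp h)).congr fun s u _ _ => by tauto

theorem PolyDecidable.forall_fintype {κ : Type*} [Fintype κ]
    {R : κ → List InputSymbol → (ι → ℕ) → Prop} (h : ∀ k, PolyDecidable B (R k)) :
    PolyDecidable B fun s u => ∀ k, R k s u := by
  classical
  suffices h' : ∀ L : Finset κ, PolyDecidable B fun s u => ∀ k ∈ L, R k s u from
    (h' Finset.univ).congr fun s u _ _ => by simp
  intro L
  induction L using Finset.induction with
  | empty => exact PolyDecidable.trivial.congr fun s u _ _ => by simp
  | insert a L _ ih => exact ((h a).and ih).congr fun s u _ _ => by simp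

section exists_mark

variable [DecidableEq ι]

/-- Move the mark `i` over the word until the program `p` accepts. -/
def existsMark (i : ι) (p : MarkProgram ι) : MarkProgram ι :=
  .seq (.load fun v => { v with flag := false, carry := true })
    (.seq (scan (shiftMark i))
      (.loop (fun v => !v.carry)
        (.seq p (.ite (fun v => v.flag)
          (.seq (scan (clearMark i)) (.load fun v => { v with carry := true }))
          (.seq (.load fun v => { v with carry := false }) (scan (shiftMark i)))))))

theorem runsIn_scan_shiftMark (i : ι) (s : List InputSymbol) (u : ι → ℕ) (v : Memory ι)
    (hv : v.carry = decide (u i + 1 = 1)) :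
    RunsIn (scan (shiftMark i)) v (contents [] [] (tape s u) [] [] [])
      { v with carry := decide (u i + 1 = s.length + 1), cell := none }
      (contents [] [] (tape s (Function.update u i (u i + 1))) [] [] []) (6 * s.length + 4) := by
  have h := runsIn_scan [] [] (tape s u) [] [] v (shiftMark i)
  rw [length_tape, hv, tape, transduce_shiftMark, Nat.add_comm 1] at h
  exact h

theorem tape_update_of_length_lt (i : ι) (s : List InputSymbol) (u : ι → ℕ) (p : ℕ)
    (hp : s.length < p) : tape s (Function.update u i p) = tape s (Function.update u i 0) := by
  refine tapeFrom_congr _ _ fun j q h1 h2 => ?_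
  by_cases hj : j = i
  · subst hj
    simp only [Function.update_self]
    omega
  · simp [hj]

/-- The mark `i` visits the positions from left to right, and the given program runs once at each
until it accepts, so the time grows by about a factor of the length. The mark must lie outside `B`
because it is present while the inner program runs. -/
theorem PolyDecidable.exists (i : ι) (hi : i ∉ B) (h : PolyDecidable B P) :
    PolyDecidable (insert i B)
      fun s u => ∃ p, 1 ≤ p ∧ p ≤ s.length ∧ P s (Function.update u i p) := by
  obtain ⟨prog, T, h⟩ := h
  refine ⟨existsMark i prog, 1 + (6 * Polynomial.X + 4) + ((Polynomial.X + 1) *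
    (T + (6 * Polynomial.X + 7)) + 1), fun s u hu hB v => ?_⟩
  have hui : u i = 0 := hB i (Set.mem_insert _ _)
  -- Loop invariant: the mark is at `t`, at most `d` rounds remain, and the carry tells whether the
  -- mark has left the word.
  have loop : ∀ d t, t + d = s.length + 1 → 1 ≤ t → ∀ v : Memory ι, v.flag = false →
      v.carry = decide (t = s.length + 1) → ∃ v',
      RunsIn (.loop (fun v => !v.carry)
        (.seq prog (.ite (fun v => v.flag)
          (.seq (scan (clearMark i)) (.load fun v => { v with carry := true }))
          (.seq (.load fun v => { v with carry := false }) (scan (shiftMark i)))))) v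
        (contents [] [] (tape s (Function.update u i t)) [] [] []) v'
        (contents [] [] (tape s u) [] [] [])
        (d * (T.eval s.length + (6 * s.length + 7)) + 1) ∧
      (v'.flag = true ↔ ∃ p, t ≤ p ∧ p ≤ s.length ∧ P s (Function.update u i p)) := by
    have hu0 : Function.update u i 0 = u := by rw [← hui, Function.update_eq_self]
    intro d
    induction d with
    | zero =>
      intro t htd ht v hf hc
      refine ⟨v, ?_, ?_⟩
      · rw [tape_update_of_length_lt i s u t (by omega), hu0]
        exact (RunsIn.loop_done (by simp [hc]; omega)).mono (by simp)
      · rw [hf]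
        simp only [Bool.false_eq_true, false_iff, not_exists, not_and]
        omega
    | succ d ih =>
      intro t htd ht v hf hc
      have hcv : (!v.carry) = true := by simp [hc]; omega
      obtain ⟨v1, h1, h2⟩ := h s (Function.update u i t) (fun j => by
        by_cases hj : j = i
        · subst hj; simp; omega
        · simpa [hj] using hu j) (fun j hj => by
        have : j ≠ i := fun h => hi (h ▸ hj)
        simpa [this] using hB j (Set.mem_insert_of_mem _ hj)) v
      cases hf1 : v1.flag with
      | true =>
        -- On acceptance the mark is erased to restore the tape; setting the carry then ends the
        -- loop, and the flag stays true.
        have h3 := runsIn_scan [] [] (tape s (Function.update u i t)) [] [] v1 (clearMark i)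
        rw [length_tape, tape, transduce_clearMark _ _ _ _ le_rfl, Function.update_idem, hu0] at h3
        have h4 := h3.seq (RunsIn.load (fun v : Memory ι => { v with carry := true }))
        refine ⟨_, (RunsIn.loop_step (c := fun v : Memory ι => !v.carry) hcv (h1.seq (RunsIn.ite_true hf1 h4))
          (RunsIn.loop_done rfl)).mono ?_, ?_⟩
        · have : 0 ≤ d * (T.eval s.length + (6 * s.length + 7)) := Nat.zero_le _
          rw [Nat.succ_mul d]
          omega
        · simp only [hf1, true_iff]
          exact ⟨t, le_rfl, by omega, h2.1 hf1⟩
      | false =>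
        -- The carry is reset first, since otherwise the pass would write a second copy of the mark
        -- on the first cell.
        have h3 := runsIn_scan_shiftMark i s (Function.update u i t)
          { v1 with carry := Bool.false } (by simp; omega)
        simp only [Function.update_self, Function.update_idem] at h3
        obtain ⟨v2, h4, h5⟩ := ih (t + 1) (by omega) (by omega)
          { v1 with carry := decide (t + 1 = s.length + 1), cell := none } hf1 rfl
        refine ⟨v2, (RunsIn.loop_step (c := fun v : Memory ι => !v.carry) hcv (h1.seq (RunsIn.ite_false hf1
          ((RunsIn.load _).seq h3))) h4).mono ?_, h5.trans ⟨?_, ?_⟩⟩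
        · rw [Nat.succ_mul d]
          omega
        · rintro ⟨p, hp1, hp2, hp3⟩
          exact ⟨p, by omega, hp2, hp3⟩
        · rintro ⟨p, hp1, hp2, hp3⟩
          rcases hp1.eq_or_lt with rfl | hlt
          · exact absurd (h2.2 hp3) (by simp [hf1])
          · exact ⟨p, hlt, hp2, hp3⟩
  have h1 := runsIn_scan_shiftMark i s u { v with flag := false, carry := true }
    (by simp [hui])
  rw [hui] at h1
  obtain ⟨v', h2, h3⟩ := loop s.length 1 (by omega) le_rfl
    { v with flag := false, carry := decide (0 + 1 = s.length + 1), cell := none } rfl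
      (by simp)
  refine ⟨v', ((RunsIn.load _).seq (h1.seq h2)).mono ?_, h3⟩
  simp only [Polynomial.eval_add, Polynomial.eval_mul, Polynomial.eval_X, Polynomial.eval_one,
    Polynomial.eval_ofNat]
  nlinarith

theorem PolyDecidable.exists_finset (L : Finset ι) (hL : ∀ i ∈ L, i ∉ B) (h : PolyDecidable B P) :
    PolyDecidable (B ∪ L) fun s u => ∃ x : ι → ℕ, (∀ i, i ∉ L → x i = u i) ∧
      (∀ i ∈ L, 1 ≤ x i ∧ x i ≤ s.length) ∧ P s x := by
  induction L using Finset.induction with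
  | empty =>
    refine (h.mono Set.subset_union_left).congr fun s u _ _ => ?_
    constructor
    · exact fun hP => ⟨u, by simp, by simp, hP⟩
    · rintro ⟨x, h1, -, h2⟩
      rwa [← funext fun i => h1 i (by simp)]
  | insert a L ha ih =>
    have := (ih fun i hi => hL i (Finset.mem_insert_of_mem hi)).exists a (by
      simp [hL a (Finset.mem_insert_self _ _), ha])
    refine (this.mono (by rw [Finset.coe_insert, Set.union_insert])).congr fun s u _ _ => ?_
    constructor
    · rintro ⟨p, hp1, hp2, x, hx1, hx2, hx3⟩
      refine ⟨x, fun i hi => ?_, fun i hi => ?_, hx3⟩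
      · simp only [Finset.mem_insert, not_or] at hi
        rw [hx1 i hi.2, Function.update_of_ne hi.1]
      · rcases Finset.mem_insert.1 hi with rfl | hi
        · rw [hx1 _ ha, Function.update_self]
          exact ⟨hp1, hp2⟩
        · exact hx2 i hi
    · rintro ⟨x, hx1, hx2, hx3⟩
      obtain ⟨h1, h2⟩ := hx2 a (Finset.mem_insert_self _ _)
      refine ⟨x a, h1, h2, x, fun i hi => ?_, fun i hi => hx2 i (Finset.mem_insert_of_mem hi), hx3⟩
      by_cases hia : i = a
      · rw [hia, Function.update_self]
      · rw [Function.update_of_ne hia, hx1 i (by simp [hia, hi])]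

theorem PolyDecidable.exists_tuple {κ : Type*} [Fintype κ] {f : κ → ι} (hf : f.Injective)
    (hB : ∀ k, f k ∉ B) (h : PolyDecidable B P) :
    PolyDecidable (B ∪ Set.range f) fun s u => ∃ x : κ → ℕ,
      (∀ k, 1 ≤ x k ∧ x k ≤ s.length) ∧ P s (Function.extend f x u) := by
  refine ((h.exists_finset (Finset.univ.image f) (by simpa using hB)).mono (by simp)).congr
    fun s u _ _ => ?_
  constructor
  · rintro ⟨x, h1, h2, h3⟩
    refine ⟨x ∘ f, fun k => h2 (f k) (by simp), ?_⟩
    have : Function.extend f (x ∘ f) u = x := by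
      funext i
      by_cases hi : ∃ k, f k = i
      · obtain ⟨k, rfl⟩ := hi
        rw [hf.extend_apply, Function.comp_apply]
      · rw [Function.extend_apply' _ _ _ hi, h1 i (by simpa using hi)]
    rwa [this]
  · rintro ⟨x, h1, h2⟩
    refine ⟨_, fun i hi => Function.extend_apply' _ _ _ (by simpa using hi), fun i hi => ?_, h2⟩
    obtain ⟨k, -, rfl⟩ := Finset.mem_image.1 hi
    rw [hf.extend_apply]
    exact h1 k

end exists_mark

/-! ### Atomic tests: order of marks and ends of variables -/

/-- A test by a single pass over the tape. -/
theorem polyDecidable_of_transducer (δ : Transducer ι) (hδ : ∀ q c, (δ q c).2 = c)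
    (h : ∀ s u, (∀ i, u i ≤ s.length) →
      ((transduce δ (false, false) (tape s u)).1.1 = true ↔ P s u)) :
    PolyDecidable B P := by
  refine ⟨.seq (.load fun v => { v with flag := false, carry := false }) (scan δ),
    6 * Polynomial.X + 5, fun s u hu _ v => ?_⟩
  have h1 := runsIn_scan [] [] (tape s u) [] [] { v with flag := false, carry := false } δ
  rw [transduce_snd_of_forall _ δ hδ, length_tape] at h1
  refine ⟨_, ((RunsIn.load _).seq h1).mono (by simp; omega), ?_⟩
  exact h s u hu

/-- Test whether the mark `i` is before the mark `j`. -/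
def testLt (i j : ι) : Transducer ι := fun q c => ((q.1 || (c.2 j && q.2), q.2 || c.2 i), c)

theorem transduce_testLt (i j : ι) (u : ι → ℕ) (f c : Bool) (o : ℕ) (s : List InputSymbol) :
    (transduce (testLt i j) (f, c) (tapeFrom u o s)).1.1 = true ↔
      f = true ∨ (o ≤ u j ∧ u j < o + s.length ∧ (c = true ∨ (o ≤ u i ∧ u i < u j))) := by
  induction s generalizing f c o with
  | nil =>
    simp only [tapeFrom, transduce, List.length_nil]
    constructor
    · exact Or.inl
    · rintro (h | h)
      · exact h
      · omega
  | cons a s ih =>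
    simp only [tapeFrom, transduce, testLt, List.length_cons] at ih ⊢
    rw [ih]
    simp only [Bool.or_eq_true, Bool.and_eq_true, decide_eq_true_eq]
    cases f <;> cases c <;> simp <;> omega

/-- The pass can only notice a mark that is present, whence the conjunct `1 ≤ u i`. -/
theorem polyDecidable_lt (i j : ι) :
    PolyDecidable B fun _ u => 1 ≤ u i ∧ u i < u j := by
  refine polyDecidable_of_transducer (testLt i j) (fun _ _ => rfl) fun s u hu => ?_
  rw [tape, transduce_testLt]
  have := hu j
  simp
  omega

/-- The position `p` of the word `s` is the end of a variable, and `b` tells whether a sign `≈`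
occurs before it. -/
def IsVarEnd (b : Bool) (s : List InputSymbol) (p : ℕ) : Prop :=
  ∃ pre rest, s = pre ++ InputSymbol.endVar :: rest ∧ p = pre.length + 1 ∧
    decide (InputSymbol.approx ∈ pre) = b

theorem IsVarEnd.le {b : Bool} {s : List InputSymbol} {p : ℕ} (h : IsVarEnd b s p) :
    1 ≤ p ∧ p ≤ s.length := by
  obtain ⟨pre, rest, rfl, rfl, -⟩ := h
  simp

/-- Test whether the mark `i` is at the end of a variable of the side `b`. -/
def testVarEnd (b : Bool) (i : ι) : Transducer ι := fun q c =>
  ((q.1 || (c.2 i && (decide (c.1 = .endVar) && (q.2 == b))), q.2 || decide (c.1 = .approx)), c)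

theorem transduce_testVarEnd (b : Bool) (i : ι) (u : ι → ℕ) (f c : Bool) (o : ℕ)
    (s : List InputSymbol) :
    (transduce (testVarEnd b i) (f, c) (tapeFrom u o s)).1.1 = true ↔
      f = true ∨ ∃ pre rest, s = pre ++ InputSymbol.endVar :: rest ∧ u i = o + pre.length ∧
        (c || decide (InputSymbol.approx ∈ pre)) = b := by
  induction s generalizing f c o with
  | nil => simp [tapeFrom, transduce]
  | cons a s ih =>
    simp only [tapeFrom, transduce, testVarEnd] at ih ⊢
    rw [ih]
    simp only [Bool.or_eq_true, Bool.and_eq_true, decide_eq_true_eq, beq_iff_eq, or_assoc]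
    refine or_congr Iff.rfl ?_
    constructor
    · rintro (⟨h1, rfl, h3⟩ | ⟨pre, rest, rfl, h2, h3⟩)
      · exact ⟨[], s, rfl, by simpa using h1, by simpa using h3⟩
      · refine ⟨a :: pre, rest, rfl, by simp [h2]; omega, ?_⟩
        rw [← h3]
        simp [Bool.or_assoc, eq_comm]
    · rintro ⟨pre, rest, h1, h2, h3⟩
      cases pre with
      | nil =>
        simp only [List.nil_append, List.cons.injEq] at h1
        exact Or.inl ⟨by simpa using h2, h1.1, by simpa using h3⟩
      | cons a' pre =>
        simp only [List.cons_append, List.cons.injEq] at h1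
        obtain ⟨rfl, rfl⟩ := h1
        refine Or.inr ⟨pre, rest, rfl, by simp at h2; omega, ?_⟩
        rw [← h3]
        simp [Bool.or_assoc, eq_comm]

theorem polyDecidable_isVarEnd (b : Bool) (i : ι) :
    PolyDecidable B fun s u => IsVarEnd b s (u i) := by
  refine polyDecidable_of_transducer (testVarEnd b i) (fun _ _ => rfl) fun s u _ => ?_
  rw [tape, transduce_testVarEnd]
  simp [IsVarEnd, Nat.add_comm 1]

end MarkProgram

/-! ### Comparison of the variables at two marks -/

/-- The bit that a symbol stands for. -/
def InputSymbol.toBit : InputSymbol → Option Bool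
  | bit b => some b
  | endVar => none
  | approx => none

/-- The bits at the beginning of a list of symbols. -/
def leadingBits : List InputSymbol → List Bool
  | InputSymbol.bit b :: s => b :: leadingBits s
  | _ => []

/-- The block of bits before the position `p`, in reverse order. -/
def bitsBefore (s : List InputSymbol) (p : ℕ) : List Bool :=
  leadingBits (s.take (p - 1)).reverse

namespace MarkProgram

open StackProgram

variable {ι : Type} {B : Set ι}

/-- The bits before the mark `i` on a tape that is read from right to left; `inside` tells whether
the pass has reached the block of the mark. -/
def blockBits (i : ι) : Bool → List (Cell ι) → List Bool
  | _, [] => []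
  | inside, c :: m => (if inside then c.1.toBit.toList else []) ++
      blockBits i (c.2 i || (inside && c.1.toBit.isSome)) m

theorem length_blockBits_le (i : ι) (inside : Bool) (m : List (Cell ι)) :
    (blockBits i inside m).length ≤ m.length := by
  induction m generalizing inside with
  | nil => simp [blockBits]
  | cons c m ih =>
    have h1 := ih (c.2 i || (inside && c.1.toBit.isSome))
    have h2 : (if inside then c.1.toBit.toList else []).length ≤ 1 := by
      split_ifs
      · cases c.1.toBit <;> simp
      · simp
    simp only [blockBits, List.length_append, List.length_cons]
    omega

theorem tape_append_singleton (s : List InputSymbol) (a : InputSymbol) (u : ι → ℕ) :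
    (tape (s ++ [a]) u).reverse =
      (a, fun i => decide (u i = s.length + 1)) :: (tape s u).reverse := by
  simp [tape, tapeFrom_append, tapeFrom, Nat.add_comm 1]

theorem blockBits_tape_of_forall_ne (i : ι) (inside : Bool) (s : List InputSymbol) (u : ι → ℕ)
    (h : ∀ p, 1 ≤ p → p ≤ s.length → u i ≠ p) :
    blockBits i inside (tape s u).reverse = if inside then leadingBits s.reverse else [] := by
  induction s using List.reverseRec generalizing inside with
  | nil => cases inside <;> rfl
  | append_singleton s a ih =>
    simp only [List.length_append, List.length_cons, List.length_nil, zero_add] at h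
    rw [tape_append_singleton, blockBits, ih _ fun p h1 h2 => h p h1 (by omega),
      List.reverse_append]
    have : decide (u i = s.length + 1) = false := by
      simpa using h (s.length + 1) (by omega) le_rfl
    simp only [this]
    cases inside <;> cases a <;> simp [InputSymbol.toBit, leadingBits]

/-- Read from the right, the cells down to and including the mark contribute nothing. Beyond it the
mark does not recur, so the bits are collected until the first symbol that is not a bit. -/
theorem blockBits_tape (i : ι) (s : List InputSymbol) (u : ι → ℕ) (h : u i ≤ s.length) :
    blockBits i false (tape s u).reverse = bitsBefore s (u i) := by
  by_cases h0 : u i = 0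
  · rw [blockBits_tape_of_forall_ne i false s u (by omega), h0]
    rfl
  induction s using List.reverseRec with
  | nil => exact absurd (by simpa using h) h0
  | append_singleton s a ih =>
    simp only [List.length_append, List.length_cons, List.length_nil, zero_add] at h
    rw [tape_append_singleton, blockBits, bitsBefore,
      List.take_append_of_le_length (by omega)]
    by_cases hi : u i = s.length + 1
    · simp only [hi, decide_true, Bool.true_or, Bool.false_eq_true, if_false, List.nil_append]
      rw [blockBits_tape_of_forall_ne i true s u fun p h1 h2 => by omega]
      simp
    · simp only [hi, decide_false, Bool.false_or, Bool.false_and, Bool.false_eq_true, if_false,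
        List.nil_append]
      exact ih (by omega)

/-- Move the cell just read to the main stack and read the next cell, copying the bits before the
mark `i` to the left stack and the bits before the mark `j` to the right stack. -/
def copyStep (i j : ι) : MarkProgram ι :=
  .seq (.ite (fun v => v.carry && (lastCell v).1.toBit.isSome)
      (.push StackName.left fun v => (lastCell v).1.toBit.getD false) (.load id))
    (.seq (.ite (fun v => v.carry' && (lastCell v).1.toBit.isSome)
        (.push StackName.right fun v => (lastCell v).1.toBit.getD false) (.load id))
      (.seq (.load fun v => { v with
          carry := (lastCell v).2 i || (v.carry && (lastCell v).1.toBit.isSome)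
          carry' := (lastCell v).2 j || (v.carry' && (lastCell v).1.toBit.isSome) })
        (.seq (.push StackName.main lastCell)
          (.pop StackName.aux fun v c => { v with cell := c }))))

/-- Move the tape back to the main stack, copying the bits before the mark `i` to the left stack
and the bits before the mark `j` to the right stack. -/
def copyBlocks (i j : ι) : MarkProgram ι :=
  .seq (.pop StackName.aux fun v c => { v with cell := c })
    (.loop (fun v => v.cell.isSome) (copyStep i j))

theorem runsIn_copyStep (i j : ι) (x : List InputSymbol) (o : List Bool) (m a : List (Cell ι))
    (l r : List Bool) (v : Memory ι) (c : Cell ι) (hc : v.cell = some c) :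
    RunsIn (copyStep i j) v (contents x o m a l r)
      { v with
        carry := c.2 i || (v.carry && c.1.toBit.isSome)
        carry' := c.2 j || (v.carry' && c.1.toBit.isSome)
        cell := a.head? }
      (contents x o (c :: m) a.tail
        ((if v.carry then c.1.toBit.toList else []) ++ l)
        ((if v.carry' then c.1.toBit.toList else []) ++ r)) 7 := by
  have hl : lastCell v = c := by simp [lastCell, hc]
  have h1 : RunsIn (.ite (fun v : Memory ι => v.carry && (lastCell v).1.toBit.isSome)
      (.push StackName.left fun v => (lastCell v).1.toBit.getD false) (.load id)) v
      (contents x o m a l r) v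
      (contents x o m a ((if v.carry then c.1.toBit.toList else []) ++ l) r) (1 + 1) := by
    cases hv : v.carry with
    | false => exact RunsIn.ite_false (by simp [hv]) (RunsIn.load _)
    | true =>
      cases hb : c.1.toBit with
      | none => exact RunsIn.ite_false (by simp [hl, hb]) (RunsIn.load _)
      | some b =>
        have := runsIn_pushLeft (x := x) (o := o) (m := m) (a := a) (l := l) (r := r) (v := v)
          fun v => (lastCell v).1.toBit.getD false
        simp only [hl, hb, Option.getD_some] at this
        exact RunsIn.ite_true (by simp [hv, hl, hb]) this
  have h2 : ∀ l', RunsIn (.ite (fun v : Memory ι => v.carry' && (lastCell v).1.toBit.isSome)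
      (.push StackName.right fun v => (lastCell v).1.toBit.getD false) (.load id)) v
      (contents x o m a l' r) v
      (contents x o m a l' ((if v.carry' then c.1.toBit.toList else []) ++ r)) (1 + 1) := by
    intro l'
    cases hv : v.carry' with
    | false => exact RunsIn.ite_false (by simp [hv]) (RunsIn.load _)
    | true =>
      cases hb : c.1.toBit with
      | none => exact RunsIn.ite_false (by simp [hl, hb]) (RunsIn.load _)
      | some b =>
        have := runsIn_pushRight (x := x) (o := o) (m := m) (a := a) (l := l') (r := r) (v := v)
          fun v => (lastCell v).1.toBit.getD false
        simp only [hl, hb, Option.getD_some] at this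
        exact RunsIn.ite_true (by simp [hv, hl, hb]) this
  have h3 := h1.seq ((h2 _).seq ((RunsIn.load fun v : Memory ι => { v with
      carry := (lastCell v).2 i || (v.carry && (lastCell v).1.toBit.isSome)
      carry' := (lastCell v).2 j || (v.carry' && (lastCell v).1.toBit.isSome) }).seq
    ((runsIn_pushMain lastCell).seq (runsIn_popAux fun v c => { v with cell := c }))))
  have hl' : ∀ f f', lastCell { v with carry := f, carry' := f' } = c := fun _ _ => hl
  simp only [hl, hl'] at h3
  exact h3.mono (by omega)

theorem runsIn_copyBlocks (i j : ι) (x : List InputSymbol) (o : List Bool) (m a : List (Cell ι))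
    (l r : List Bool) (v : Memory ι) :
    ∃ v', RunsIn (copyBlocks i j) v (contents x o m a l r) v'
      (contents x o (a.reverse ++ m) [] ((blockBits i v.carry a).reverse ++ l)
        ((blockBits j v.carry' a).reverse ++ r)) (8 * a.length + 2) := by
  suffices h : ∃ v', RunsIn (.loop (fun v => v.cell.isSome) (copyStep i j))
      { v with cell := a.head? } (contents x o m a.tail l r) v'
      (contents x o (a.reverse ++ m) [] ((blockBits i v.carry a).reverse ++ l)
        ((blockBits j v.carry' a).reverse ++ r)) (8 * a.length + 1) by
    obtain ⟨v', h⟩ := h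
    exact ⟨v', ((runsIn_popAux fun v c => { v with cell := c }).seq h).mono (by omega)⟩
  induction a generalizing v m l r with
  | nil => exact ⟨_, RunsIn.loop_done rfl⟩
  | cons c a ih =>
    have h1 := runsIn_copyStep i j x o m a l r { v with cell := some c } c rfl
    obtain ⟨v', h2⟩ := ih (c :: m) ((if v.carry then c.1.toBit.toList else []) ++ l)
      ((if v.carry' then c.1.toBit.toList else []) ++ r)
      { v with
        carry := c.2 i || (v.carry && c.1.toBit.isSome)
        carry' := c.2 j || (v.carry' && c.1.toBit.isSome) }
    refine ⟨v', ?_⟩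
    have h3 := RunsIn.loop_step (c := fun v : Memory ι => v.cell.isSome) rfl h1 h2
    have hrev : ∀ (b : Bool) (t : Option Bool), (if b then t.toList else []).reverse =
        if b then t.toList else [] := by
      intro b t; cases b <;> cases t <;> rfl
    simp only [blockBits, List.reverse_append, List.append_assoc, List.reverse_cons,
      List.singleton_append, hrev]
    exact h3.mono (by simp; omega)

/-- Compare the left and the right stack, and empty them. -/
def compareBits : MarkProgram ι :=
  .seq (.load fun v => { v with flag := true })
    (.seq (.pop StackName.left fun v b => { v with bit := b })
      (.seq (.pop StackName.right fun v b => { v with bit' := b })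
        (.loop (fun v => v.bit.isSome || v.bit'.isSome)
          (.seq (.load fun v => { v with flag := v.flag && decide (v.bit = v.bit') })
            (.seq (.pop StackName.left fun v b => { v with bit := b })
              (.pop StackName.right fun v b => { v with bit' := b }))))))

theorem runsIn_compareBits (x : List InputSymbol) (o : List Bool) (m a : List (Cell ι))
    (l r : List Bool) (v : Memory ι) (N : ℕ) (hl : l.length ≤ N) (hr : r.length ≤ N) :
    ∃ v', RunsIn compareBits v (contents x o m a l r) v' (contents x o m a [] []) (4 * N + 4) ∧
      (v'.flag = true ↔ l = r) := by
  -- The loop continues while either stack still yields a bit, so a difference in length shows up as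
  -- a comparison of `some` with `none`.
  suffices h : ∀ v : Memory ι,
      ∃ v', RunsIn (.loop (fun v => v.bit.isSome || v.bit'.isSome)
          (.seq (.load fun v => { v with flag := v.flag && decide (v.bit = v.bit') })
            (.seq (.pop StackName.left fun v b => { v with bit := b })
              (.pop StackName.right fun v b => { v with bit' := b }))))
        { v with bit := l.head?, bit' := r.head? } (contents x o m a l.tail r.tail) v'
        (contents x o m a [] []) (4 * N + 1) ∧ (v'.flag = true ↔ v.flag = true ∧ l = r) by
    obtain ⟨v', h1, h2⟩ := h { v with flag := true }
    exact ⟨v', ((RunsIn.load _).seq ((runsIn_popLeft fun v b => { v with bit := b }).seq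
      ((runsIn_popRight fun v b => { v with bit' := b }).seq h1))).mono (by omega),
      h2.trans (by simp)⟩
  induction N generalizing l r with
  | zero =>
    intro v
    obtain rfl : l = [] := List.eq_nil_of_length_eq_zero (by omega)
    obtain rfl : r = [] := List.eq_nil_of_length_eq_zero (by omega)
    exact ⟨_, (RunsIn.loop_done rfl).mono (by omega), by simp⟩
  | succ N ih =>
    intro v
    by_cases hnil : l = [] ∧ r = []
    · obtain ⟨rfl, rfl⟩ := hnil
      exact ⟨_, (RunsIn.loop_done rfl).mono (by omega), by simp⟩
    · obtain ⟨v', h1, h2⟩ := ih l.tail r.tail (by simp; omega) (by simp; omega)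
        { v with flag := v.flag && decide (l.head? = r.head?) }
      refine ⟨v', (RunsIn.loop_step ?_ ((RunsIn.load _).seq
        ((runsIn_popLeft fun v b => { v with bit := b }).seq
          (runsIn_popRight fun v b => { v with bit' := b }))) h1).mono (by omega), h2.trans ?_⟩
      · rw [not_and_or] at hnil
        rcases hnil with h | h
        · cases l with
          | nil => exact absurd rfl h
          | cons => simp
        · cases r with
          | nil => exact absurd rfl h
          | cons => simp
      · simp only [Bool.and_eq_true, decide_eq_true_eq, and_assoc]
        refine and_congr Iff.rfl ?_
        cases l <;> cases r <;> simp_all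

/-- The tape moves to the auxiliary stack, and both blocks are copied while it moves back. Both
copies are reversed, which does not affect their equality. -/
theorem polyDecidable_bitsBefore_eq (i j : ι) :
    PolyDecidable B fun s u => bitsBefore s (u i) = bitsBefore s (u j) := by
  refine ⟨.seq (.load fun v => { v with carry := false, carry' := false })
    (.seq (scanRight idTransducer) (.seq (copyBlocks i j) compareBits)),
    15 * Polynomial.X + 9, fun s u hu _ v => ?_⟩
  have h1 := runsIn_scanRight [] [] (tape s u) [] [] []
    { v with carry := false, carry' := false } idTransducer
  simp only [transduce_idTransducer, List.append_nil] at h1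
  obtain ⟨v1, h2⟩ := runsIn_copyBlocks i j [] [] [] (tape s u).reverse [] []
    { v with carry := false, carry' := false, cell := none }
  have hN : ∀ i, ((blockBits i false (tape s u).reverse).reverse ++ []).length ≤ s.length := by
    intro i
    have := length_blockBits_le i false (tape s u).reverse
    simpa [length_tape] using this
  obtain ⟨v2, h3, h4⟩ := runsIn_compareBits [] [] ((tape s u).reverse.reverse ++ []) [] _ _ v1
    s.length (hN i) (hN j)
  refine ⟨v2, ?_, ?_⟩
  · have h5 := (RunsIn.load fun v : Memory ι => { v with carry := false, carry' := false }).seq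
      (h1.seq (h2.seq h3))
    simp only [List.reverse_reverse, List.append_nil, length_tape, List.length_reverse] at h5
    exact h5.mono (by simp; omega)
  · rw [h4, blockBits_tape i s u (hu i), blockBits_tape j s u (hu j)]
    simp

/-! ### Deciding the covering relation on the written identity -/

/-- The relation `Covers` between the two sides of a written identity. -/
def CoversWritten (k : ℕ) (b : Bool) (s : List InputSymbol) : Prop :=
  ∀ p : Fin k → ℕ, (∀ i, IsVarEnd b s (p i)) → ∃ p' : Fin k → ℕ, (∀ i, IsVarEnd (!b) s (p' i)) ∧
    ∀ y, IsVarEnd (!b) s y → ∃ z, IsVarEnd b s z ∧ bitsBefore s y = bitsBefore s z ∧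
      ∀ i, (p' i < y ↔ p i < z) ∧ (y < p' i ↔ z < p i)

/-- The marks that are used to decide `CoversWritten`. -/
abbrev CoverMark (k : ℕ) : Type := (Fin k ⊕ Fin k) ⊕ Bool

/-- The formula is built from the inside out: a mark for `z`, one for `y`, then the tuples `p'` and
`p`, each universal quantifier being a negated existential one. All marks belong to the working set,
so the search starts from an unmarked tape. -/
theorem polyDecidable_coversWritten (k : ℕ) (b : Bool) :
    PolyDecidable (ι := CoverMark k) Set.univ fun s _ => CoversWritten k b s := by
  let p : Fin k → CoverMark k := fun i => .inl (.inl i)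
  let p' : Fin k → CoverMark k := fun i => .inl (.inr i)
  let y : CoverMark k := .inr false
  let z : CoverMark k := .inr true
  have hp : p.Injective := fun i j h => by simpa [p] using h
  have hp' : p'.Injective := fun i j h => by simpa [p'] using h
  have h1 : PolyDecidable ({z} : Set (CoverMark k)) fun s u => ∃ t, 1 ≤ t ∧ t ≤ s.length ∧
      (IsVarEnd b s (Function.update u z t z) ∧
        bitsBefore s (Function.update u z t y) = bitsBefore s (Function.update u z t z) ∧
        ∀ i, ((1 ≤ Function.update u z t (p' i) ∧
            Function.update u z t (p' i) < Function.update u z t y) ↔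
          (1 ≤ Function.update u z t (p i) ∧
            Function.update u z t (p i) < Function.update u z t z)) ∧
        ((1 ≤ Function.update u z t y ∧
            Function.update u z t y < Function.update u z t (p' i)) ↔
          (1 ≤ Function.update u z t z ∧
            Function.update u z t z < Function.update u z t (p i)))) :=
    (PolyDecidable.exists z (Set.notMem_empty _) ((polyDecidable_isVarEnd b z).and
      ((polyDecidable_bitsBefore_eq y z).and (PolyDecidable.forall_fintype fun i =>
        ((polyDecidable_lt (p' i) y).iff (polyDecidable_lt (p i) z)).and
          ((polyDecidable_lt y (p' i)).iff (polyDecidable_lt z (p i))))))).mono (by simp)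
  have h2 := (((polyDecidable_isVarEnd (!b) y).and h1.not).exists y (by simp [y, z])).not
  have h3 := ((PolyDecidable.forall_fintype fun i => polyDecidable_isVarEnd (!b) (p' i)).and
    h2).exists_tuple hp' (by simp [p', y, z])
  have h4 := (((PolyDecidable.forall_fintype fun i => polyDecidable_isVarEnd b (p i)).and
    h3.not).exists_tuple hp (by simp [p, p', y, z])).not
  refine (h4.mono (Set.subset_univ _)).congr fun s u _ _ => ?_
  have e1 : ∀ (f f' : Fin k → ℕ) i,
      Function.extend p' f' (Function.extend p f u) (p i) = f i := by
    intro f f' i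
    rw [Function.extend_apply' _ _ _ (by simp [p, p']), hp.extend_apply]
  have n1 : ∀ i, p i ≠ y := by simp [p, y]
  have n2 : ∀ i, p i ≠ z := by simp [p, z]
  have n3 : ∀ i, p' i ≠ y := by simp [p', y]
  have n4 : ∀ i, p' i ≠ z := by simp [p', z]
  have n5 : y ≠ z := by simp [y, z]
  -- The marks are pairwise distinct, so each can be evaluated through the updates made for the
  -- others. What then remains besides `CoversWritten` are bounds, which `IsVarEnd.le` supplies.
  simp only [hp.extend_apply, hp'.extend_apply, e1, Function.update_of_ne, ne_eq, n1, n2, n3, n4,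
    n5, not_false_eq_true, Function.update_self]
  unfold CoversWritten
  push Not
  constructor
  · intro h f hf
    obtain ⟨f', hf', h5, h6⟩ := h f (fun i => (hf i).le) hf
    refine ⟨f', h5, fun t ht => ?_⟩
    obtain ⟨t', -, -, ht', h7, h8⟩ := h6 t ht.le.1 ht.le.2 ht
    refine ⟨t', ht', h7, fun i => ?_⟩
    have := h8 i
    have := (hf i).le
    have := hf' i
    have := ht.le
    have := ht'.le
    omega
  · intro h f _ hf
    obtain ⟨f', hf', h5⟩ := h f hf
    refine ⟨f', fun i => (hf' i).le, hf', fun t _ _ ht => ?_⟩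
    obtain ⟨t', ht', h7, h8⟩ := h5 t ht
    refine ⟨t', ht'.le.1, ht'.le.2, ht', h7, fun i => ?_⟩
    have := h8 i
    have := (hf i).le
    have := (hf' i).le
    have := ht.le
    have := ht'.le
    omega

end MarkProgram

/-! ### Positions of the variables in the written identity -/

theorem Nat.bits_inj {m n : ℕ} (h : m.bits = n.bits) : m = n :=
  Nat.eq_of_testBit_eq fun i => by rw [Nat.testBit_eq_inth, Nat.testBit_eq_inth, h]

/-- A list of variables as a part of the machine input. -/
def encodeLetters (l : List ℕ) : List InputSymbol :=
  l.flatMap fun x => x.bits.map InputSymbol.bit ++ [InputSymbol.endVar]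

theorem encodeLetters_append (l l' : List ℕ) :
    encodeLetters (l ++ l') = encodeLetters l ++ encodeLetters l' :=
  List.flatMap_append

theorem encodeLetters_cons (x : ℕ) (l : List ℕ) :
    encodeLetters (x :: l) =
      x.bits.map InputSymbol.bit ++ InputSymbol.endVar :: encodeLetters l := by
  simp [encodeLetters]

theorem approx_notMem_encodeLetters (l : List ℕ) : InputSymbol.approx ∉ encodeLetters l := by
  simp [encodeLetters]

theorem leadingBits_map_append (bs : List Bool) {s : List InputSymbol} (h : leadingBits s = []) :
    leadingBits (bs.map InputSymbol.bit ++ s) = bs := by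
  induction bs with
  | nil => exact h
  | cons b bs ih => simp [leadingBits, ih]

/-- A nonempty written list finishes with an end mark, which stops a backward reading; for the empty
list this is the hypothesis on `pre`. Hence digits of different variables never run together. -/
theorem leadingBits_reverse_encodeLetters (pre : List InputSymbol)
    (hpre : leadingBits pre.reverse = []) (l : List ℕ) :
    leadingBits (pre ++ encodeLetters l).reverse = [] := by
  induction l using List.reverseRec with
  | nil => simpa [encodeLetters] using hpre
  | append_singleton l x _ =>
    simp [encodeLetters, leadingBits]

/-- The end of the variable with number `t` in a written list of variables. -/
def varEnd (l : List ℕ) (t : ℕ) : ℕ := (encodeLetters (l.take (t + 1))).length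

theorem take_succ_encodeLetters {l : List ℕ} {t x : ℕ} (h : l[t]? = some x) :
    encodeLetters (l.take (t + 1)) =
      (encodeLetters (l.take t) ++ x.bits.map InputSymbol.bit) ++ [InputSymbol.endVar] := by
  rw [List.take_add_one, h, encodeLetters_append]
  simp [encodeLetters]

theorem encodeLetters_eq {l : List ℕ} {t x : ℕ} (h : l[t]? = some x) :
    encodeLetters l = (encodeLetters (l.take t) ++ x.bits.map InputSymbol.bit) ++
      InputSymbol.endVar :: encodeLetters (l.drop (t + 1)) := by
  conv_lhs => rw [← List.take_append_drop (t + 1) l, encodeLetters_append,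
    take_succ_encodeLetters h]
  simp

theorem varEnd_eq {l : List ℕ} {t x : ℕ} (h : l[t]? = some x) :
    varEnd l t = (encodeLetters (l.take t) ++ x.bits.map InputSymbol.bit).length + 1 := by
  rw [varEnd, take_succ_encodeLetters h, List.length_append]
  rfl

/-- Every variable contributes at least its end mark, even the index 0, which has no binary digits.
-/
theorem varEnd_lt_varEnd (l : List ℕ) {s t : ℕ} (hst : s < t) (ht : t < l.length) :
    varEnd l s < varEnd l t := by
  rw [varEnd_eq (List.getElem?_eq_getElem ht), varEnd]
  have : l.take t = l.take (s + 1) ++ (l.drop (s + 1)).take (t - (s + 1)) := by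
    rw [← List.take_add]
    congr 1
    omega
  rw [this, encodeLetters_append]
  simp only [List.length_append]
  omega

theorem varEnd_lt_iff (l : List ℕ) {s t : ℕ} (hs : s < l.length) (ht : t < l.length) :
    varEnd l s < varEnd l t ↔ s < t := by
  refine ⟨fun h => ?_, fun h => varEnd_lt_varEnd l h ht⟩
  by_contra hts
  rcases (not_lt.1 hts).eq_or_lt with rfl | hlt
  · exact lt_irrefl _ h
  · exact lt_asymm h (varEnd_lt_varEnd l hlt hs)

theorem bitsBefore_varEnd (pre rest : List InputSymbol) (hpre : leadingBits pre.reverse = [])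
    {l : List ℕ} {t x : ℕ} (h : l[t]? = some x) :
    bitsBefore (pre ++ encodeLetters l ++ rest) (pre.length + varEnd l t) = x.bits.reverse := by
  rw [varEnd_eq h, encodeLetters_eq h, bitsBefore]
  have h1 : pre ++ ((encodeLetters (l.take t) ++ x.bits.map InputSymbol.bit) ++
      InputSymbol.endVar :: encodeLetters (l.drop (t + 1))) ++ rest =
      (pre ++ encodeLetters (l.take t) ++ x.bits.map InputSymbol.bit) ++
        (InputSymbol.endVar :: encodeLetters (l.drop (t + 1)) ++ rest) := by
    simp
  rw [h1, List.take_left' (by simp), List.reverse_append, ← List.map_reverse]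
  exact leadingBits_map_append _ (leadingBits_reverse_encodeLetters _ hpre _)

/-- Digits are never end marks, so an end mark within the code of the first variable is its last
symbol; any later one belongs to the rest of the list. -/
theorem exists_varEnd_of_eq {l : List ℕ} {pre rest : List InputSymbol}
    (h : encodeLetters l = pre ++ InputSymbol.endVar :: rest) :
    ∃ t < l.length, pre.length + 1 = varEnd l t := by
  induction l generalizing pre with
  | nil => simp [encodeLetters] at h
  | cons x l ih =>
    have key : varEnd (x :: l) 0 = x.bits.length + 1 := by simp [varEnd, encodeLetters]
    rw [encodeLetters_cons, List.append_eq_append_iff] at h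
    rcases h with ⟨c, rfl, hc⟩ | ⟨c, hb, hc⟩
    · cases c with
      | nil => exact ⟨0, by simp, by simp [key]⟩
      | cons a c =>
        simp only [List.cons_append, List.cons.injEq] at hc
        obtain ⟨t, ht, hte⟩ := ih hc.2
        refine ⟨t + 1, by simpa using ht, ?_⟩
        rw [varEnd, List.take_succ_cons, encodeLetters_cons]
        simp only [varEnd] at hte
        simp only [List.length_append, List.length_map, List.length_cons]
        omega
    · cases c with
      | nil =>
        refine ⟨0, by simp, ?_⟩
        rw [key, ← List.length_map (f := InputSymbol.bit), hb, List.append_nil]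
      | cons a c =>
        simp only [List.cons_append, List.cons.injEq] at hc
        have : InputSymbol.endVar ∈ x.bits.map InputSymbol.bit := by rw [hb, ← hc.1]; simp
        simp at this

/-- The sign `≈` occurs only once, so an end mark without a preceding `≈` lies in the left-hand
word. -/
theorem isVarEnd_false_iff (l l' : List ℕ) (p : ℕ) :
    MarkProgram.IsVarEnd false (encodeLetters l ++ InputSymbol.approx :: encodeLetters l') p ↔
      ∃ t < l.length, p = varEnd l t := by
  constructor
  · rintro ⟨pre, rest, h, rfl, happ⟩
    rw [decide_eq_false_iff_not] at happ
    rw [List.append_eq_append_iff] at h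
    rcases h with ⟨c, rfl, hc⟩ | ⟨c, hb, hc⟩
    · cases c with
      | nil => simp at hc
      | cons a c =>
        simp only [List.cons_append, List.cons.injEq] at hc
        exact absurd (by simp [← hc.1]) happ
    · cases c with
      | nil => simp at hc
      | cons a c =>
        simp only [List.cons_append, List.cons.injEq] at hc
        rw [← hc.1] at hb
        exact exists_varEnd_of_eq hb
  · rintro ⟨t, ht, rfl⟩
    have hx := List.getElem?_eq_getElem ht
    refine ⟨_, encodeLetters (l.drop (t + 1)) ++ InputSymbol.approx :: encodeLetters l', ?_,
      varEnd_eq hx, ?_⟩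
    · rw [encodeLetters_eq hx]
      simp
    · simp [approx_notMem_encodeLetters]

theorem isVarEnd_true_iff (l l' : List ℕ) (p : ℕ) :
    MarkProgram.IsVarEnd true (encodeLetters l ++ InputSymbol.approx :: encodeLetters l') p ↔
      ∃ t < l'.length, p = (encodeLetters l).length + 1 + varEnd l' t := by
  constructor
  · rintro ⟨pre, rest, h, rfl, happ⟩
    rw [decide_eq_true_eq] at happ
    rw [List.append_eq_append_iff] at h
    rcases h with ⟨c, rfl, hc⟩ | ⟨c, hb, hc⟩
    · cases c with
      | nil => simp at hc
      | cons a c =>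
        simp only [List.cons_append, List.cons.injEq] at hc
        obtain ⟨t, ht, hte⟩ := exists_varEnd_of_eq hc.2
        refine ⟨t, ht, ?_⟩
        rw [← hte]
        simp only [List.length_append, List.length_cons]
        omega
    · exact absurd (hb ▸ List.mem_append_left c happ) (approx_notMem_encodeLetters l)
  · rintro ⟨t, ht, rfl⟩
    have hx := List.getElem?_eq_getElem ht
    refine ⟨encodeLetters l ++ InputSymbol.approx ::
      (encodeLetters (l'.take t) ++ l'[t].bits.map InputSymbol.bit),
      encodeLetters (l'.drop (t + 1)), ?_, ?_, ?_⟩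
    · rw [encodeLetters_eq hx]
      simp
    · rw [varEnd_eq hx]
      simp only [List.length_append, List.length_cons]
      omega
    · simp

/-! ### From the written identity back to its words -/

namespace MarkProgram

/-- The maps `e` and `e'` identify letters with the ends of their codes, preserving order, and the
digits before an end determine the letter. Stating this for abstract maps lets one proof serve both
directions of the identity. -/
theorem coversWritten_iff_of_forall {k : ℕ} {b : Bool} {s : List InputSymbol} {l l' : List ℕ}
    {e e' : ℕ → ℕ} (he : ∀ p, IsVarEnd b s p ↔ ∃ t < l.length, p = e t)
    (he' : ∀ p, IsVarEnd (!b) s p ↔ ∃ t < l'.length, p = e' t)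
    (hlt : ∀ t < l.length, ∀ u < l.length, e t < e u ↔ t < u)
    (hlt' : ∀ t < l'.length, ∀ u < l'.length, e' t < e' u ↔ t < u)
    (hbits : ∀ t x, l[t]? = some x → bitsBefore s (e t) = x.bits.reverse)
    (hbits' : ∀ t x, l'[t]? = some x → bitsBefore s (e' t) = x.bits.reverse) :
    CoversWritten k b s ↔ Covers k l l' := by
  have hsame : ∀ y < l'.length, ∀ z < l.length,
      bitsBefore s (e' y) = bitsBefore s (e z) ↔ l'[y]? = l[z]? := by
    intro y hy z hz
    rw [hbits' y _ (List.getElem?_eq_getElem hy), hbits z _ (List.getElem?_eq_getElem hz),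
      List.getElem?_eq_getElem hy, List.getElem?_eq_getElem hz, Option.some.injEq,
      List.reverse_inj]
    exact ⟨Nat.bits_inj, fun h => by rw [h]⟩
  constructor
  · intro h p hp
    obtain ⟨q, hq, h1⟩ := h (fun i => e (p i)) fun i => (he _).2 ⟨p i, hp i, rfl⟩
    choose p' hp' hq' using fun i => (he' _).1 (hq i)
    refine ⟨p', hp', fun y hy => ?_⟩
    obtain ⟨z', hz', h2, h3⟩ := h1 (e' y) ((he' _).2 ⟨y, hy, rfl⟩)
    obtain ⟨z, hz, rfl⟩ := (he _).1 hz'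
    refine ⟨z, hz, (hsame y hy z hz).1 h2, fun i => ?_⟩
    have := h3 i
    rwa [hq' i, hlt' _ (hp' i) _ hy, hlt' _ hy _ (hp' i), hlt _ (hp i) _ hz,
      hlt _ hz _ (hp i)] at this
  · intro h q hq
    choose p hp hqp using fun i => (he _).1 (hq i)
    obtain ⟨p', hp', h1⟩ := h p hp
    refine ⟨fun i => e' (p' i), fun i => (he' _).2 ⟨p' i, hp' i, rfl⟩, fun y' hy' => ?_⟩
    obtain ⟨y, hy, rfl⟩ := (he' _).1 hy'
    obtain ⟨z, hz, h2, h3⟩ := h1 y hy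
    refine ⟨e z, (he _).2 ⟨z, hz, rfl⟩, (hsame y hy z hz).2 h2, fun i => ?_⟩
    rw [hqp i, hlt' _ (hp' i) _ hy, hlt' _ hy _ (hp' i), hlt _ (hp i) _ hz, hlt _ hz _ (hp i)]
    exact h3 i

theorem coversWritten_iff (k : ℕ) (l l' : List ℕ) :
    (CoversWritten k false (encodeLetters l ++ InputSymbol.approx :: encodeLetters l') ↔
      Covers k l l') ∧
    (CoversWritten k true (encodeLetters l ++ InputSymbol.approx :: encodeLetters l') ↔
      Covers k l' l) := by
  have hlt := fun t (ht : t < l.length) u (hu : u < l.length) => varEnd_lt_iff l ht hu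
  have hlt' : ∀ t < l'.length, ∀ u < l'.length, (encodeLetters l).length + 1 + varEnd l' t <
      (encodeLetters l).length + 1 + varEnd l' u ↔ t < u := fun t ht u hu => by
    rw [Nat.add_lt_add_iff_left, varEnd_lt_iff l' ht hu]
  have hbits : ∀ t x, l[t]? = some x → bitsBefore
      (encodeLetters l ++ InputSymbol.approx :: encodeLetters l') (varEnd l t) =
        x.bits.reverse := fun t x hx => by
    simpa using bitsBefore_varEnd [] (InputSymbol.approx :: encodeLetters l') rfl hx
  have hbits' : ∀ t x, l'[t]? = some x → bitsBefore
      (encodeLetters l ++ InputSymbol.approx :: encodeLetters l')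
        ((encodeLetters l).length + 1 + varEnd l' t) = x.bits.reverse := fun t x hx => by
    simpa using bitsBefore_varEnd (encodeLetters l ++ [InputSymbol.approx]) []
      (by simp [leadingBits]) hx
  exact ⟨coversWritten_iff_of_forall (isVarEnd_false_iff l l') (isVarEnd_true_iff l l') hlt hlt'
      hbits hbits',
    coversWritten_iff_of_forall (isVarEnd_true_iff l l') (isVarEnd_false_iff l l') hlt' hlt
      hbits' hbits⟩

/-! ### Input, output and the Turing machine -/

open StackProgram

variable {ι : Type}

/-- Move the input to the main stack. -/
def loadInput : MarkProgram ι :=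
  .seq (.seq (.pop StackName.input fun v (a : Option InputSymbol) =>
      { v with cell := a.map fun a => (a, fun _ => false) })
    (.loop (fun v => v.cell.isSome) (.seq (.push StackName.aux lastCell)
      (.pop StackName.input fun v (a : Option InputSymbol) =>
        { v with cell := a.map fun a => (a, fun _ => false) })))) rewind

theorem runsIn_loadInput (s : List InputSymbol) (v : Memory ι) :
    ∃ v', RunsIn loadInput v (contents s [] [] [] [] []) v'
      (contents [] [] (tape s fun _ => 0) [] [] []) (6 * s.length + 4) := by
  have h : ∀ (s : List InputSymbol) (a : List (Cell ι)) (v : Memory ι), ∃ v',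
      RunsIn (.loop (fun v => v.cell.isSome) (.seq (.push StackName.aux lastCell)
        (.pop StackName.input fun v (a : Option InputSymbol) =>
          { v with cell := a.map fun a => (a, fun _ => false) })))
        { v with cell := s.head?.map fun a => (a, fun _ => false) }
        (contents s.tail [] [] a [] []) v'
        (contents [] [] [] ((s.map fun a => (a, fun _ => false)).reverse ++ a) [] [])
        (3 * s.length + 1) := by
    intro s
    induction s with
    | nil => exact fun a v => ⟨_, RunsIn.loop_done rfl⟩
    | cons c s ih =>
      intro a v
      obtain ⟨v', h⟩ := ih ((c, fun _ => false) :: a) v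
      have h1 := RunsIn.loop_step (c := fun v : Memory ι => v.cell.isSome)
        (v := { v with cell := some (c, fun _ => false) }) rfl
        ((runsIn_pushAux lastCell).seq (runsIn_popInput fun v (a : Option InputSymbol) =>
          { v with cell := a.map fun a => (a, fun _ => false) })) h
      refine ⟨v', ?_⟩
      rw [List.map_cons, List.reverse_cons, List.append_assoc]
      exact h1.mono (by simp; omega)
  have ht : ∀ (s : List InputSymbol) (o : ℕ), 1 ≤ o →
      (s.map fun a => (a, fun _ => false) : List (Cell ι)) = tapeFrom (fun _ => 0) o s := by
    intro s
    induction s with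
    | nil => exact fun _ _ => rfl
    | cons a s ih =>
      intro o ho
      have : decide (0 = o) = false := decide_eq_false (by omega)
      rw [List.map_cons, ih (o + 1) (by omega), tapeFrom, this]
  obtain ⟨v', h1⟩ := h s [] v
  have h2 := runsIn_rewind [] [] [] ((s.map fun a => (a, fun _ => false)).reverse ++ []) [] [] v'
  refine ⟨{ v' with cell := none }, (((runsIn_popInput fun v (a : Option InputSymbol) =>
    { v with cell := a.map fun a => (a, fun _ => false) }).seq h1).seq ?_).mono
      (T := 1 + (3 * s.length + 1) + (3 * s.length + 2)) (by omega)⟩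
  rw [ht s 1 le_rfl] at h2 ⊢
  simpa [tape, length_tapeFrom] using h2

/-- Empty the main stack and output the flag. -/
def writeOutput : MarkProgram ι :=
  .seq (.seq (.pop StackName.main fun v c => { v with cell := c })
    (.loop (fun v => v.cell.isSome) (.pop StackName.main fun v c => { v with cell := c })))
    (.seq (.push StackName.output fun v => v.flag) (.load fun _ => Memory.init ι))

/-- A halting configuration must have its initial memory and no stack content except the output, so
the tape is erased and the memory reset. -/
theorem runsIn_writeOutput (m : List (Cell ι)) (v : Memory ι) :
    RunsIn writeOutput v (contents [] [] m [] [] []) (Memory.init ι)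
      (contents [] [v.flag] [] [] [] []) (2 * m.length + 4) := by
  have h : ∀ (m : List (Cell ι)) (v : Memory ι),
      RunsIn (.loop (fun v => v.cell.isSome) (.pop StackName.main fun v c => { v with cell := c }))
        { v with cell := m.head? } (contents [] [] m.tail [] [] []) { v with cell := none }
        (contents [] [] [] [] [] []) (2 * m.length + 1) := by
    intro m v
    induction m with
    | nil => exact RunsIn.loop_done rfl
    | cons c m ih =>
      have h1 := RunsIn.loop_step (c := fun v : Memory ι => v.cell.isSome)
        (v := { v with cell := some c }) rfl
        (runsIn_popMain fun v c => { v with cell := c }) ih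
      exact h1.mono (by simp; omega)
  exact (((runsIn_popMain fun v c => { v with cell := c }).seq (h m v)).seq
    ((runsIn_pushOutput fun v => v.flag).seq (RunsIn.load _))).mono (by omega)

theorem PolyDecidable.exists_runsIn {R : List InputSymbol → Prop} [DecidablePred R]
    (h : PolyDecidable (ι := ι) Set.univ fun s _ => R s) :
    ∃ (prog : MarkProgram ι) (T : Polynomial ℕ), ∀ s,
      RunsIn prog (Memory.init ι) (contents s [] [] [] [] []) (Memory.init ι)
        (contents [] [decide (R s)] [] [] [] []) (T.eval s.length) := by
  obtain ⟨p, T, h⟩ := h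
  refine ⟨.seq loadInput (.seq p writeOutput), T + 8 * Polynomial.X + 8, fun s => ?_⟩
  obtain ⟨v1, h1⟩ := runsIn_loadInput s (Memory.init ι)
  obtain ⟨v2, h2, h3⟩ := h s (fun _ => 0) (fun _ => Nat.zero_le _) (fun _ _ => rfl) v1
  have h4 := runsIn_writeOutput (tape s fun _ => 0) v2
  have hf : v2.flag = decide (R s) := by rw [Bool.eq_iff_iff, h3, decide_eq_true_eq]
  rw [length_tape, hf] at h4
  exact (h1.seq (h2.seq h4)).mono (by simp; omega)

/-- The Turing machine that runs a program. -/
noncomputable def machine [Fintype ι] (prog : MarkProgram ι) : Turing.FinTM2 where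
  K := StackName
  k₀ := .input
  k₁ := .output
  Γ := StackName.Alphabet ι
  Λ := Label prog
  main := entry prog
  σ := Memory ι
  initialState := Memory.init ι
  Γk₀Fin := inferInstanceAs (Fintype InputSymbol)
  m := code prog id none

theorem machine_outputs [Fintype ι] {prog : MarkProgram ι} {s : List InputSymbol} {b : Bool} {T : ℕ}
    (h : RunsIn prog (Memory.init ι) (contents s [] [] [] [] []) (Memory.init ι)
      (contents [] [b] [] [] [] []) T) :
    Nonempty (Turing.TM2OutputsInTime (machine prog) s (some [b]) T) := by
  obtain ⟨t, ht, hr⟩ := h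
  have h1 := hr.steps (m := code prog id none) id none fun _ => rfl
  refine ⟨⟨⟨t, ?_⟩, ht⟩⟩
  have hi : Turing.initList (machine prog) s =
      ⟨some (entry prog), Memory.init ι, contents s [] [] [] [] []⟩ := by
    unfold Turing.initList
    congr 1
    funext k
    cases k <;> rfl
  have ho : Turing.haltList (machine prog) [b] =
      ⟨none, Memory.init ι, contents [] [b] [] [] [] []⟩ := by
    unfold Turing.haltList
    congr 1
    funext k
    cases k <;> rfl
  rw [hi, Option.map_some, ho]
  exact h1

theorem polyDecidable_holdsIn (k : ℕ) : PolyDecidable (ι := CoverMark k) Set.univ fun s _ =>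
    CoversWritten k false s ∧ CoversWritten k true s :=
  (polyDecidable_coversWritten k false).and (polyDecidable_coversWritten k true)

end MarkProgram

/-! ### The polynomial time bounds -/

theorem exists_machine (n : ℕ) : ∃ (ι : Type) (_ : Fintype ι) (prog : MarkProgram ι)
    (T : Polynomial ℕ), ∀ I : SemigroupIdentity,
      Nonempty (Turing.TM2OutputsInTime (MarkProgram.machine prog) (encodeIdentity I)
        (some [checkId (TriBoolMatrix n) I]) (T.eval (encodeIdentity I).length)) := by
  classical
  cases n with
  | zero =>
    -- All matrices of size 0 are equal, so the constant answer `true` is correct; the choice of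
    -- marks is immaterial.
    obtain ⟨prog, T, h⟩ :=
      (MarkProgram.PolyDecidable.trivial (ι := Unit) (B := Set.univ)).exists_runsIn
        (R := fun _ => True)
    refine ⟨Unit, inferInstance, prog, T, fun I => MarkProgram.machine_outputs ?_⟩
    have : checkId (TriBoolMatrix 0) I = decide True := by simp [checkId, holdsIn_zero]
    rw [this]
    exact h _
  | succ k =>
    obtain ⟨prog, T, h⟩ := (MarkProgram.polyDecidable_holdsIn k).exists_runsIn
      (R := fun s => MarkProgram.CoversWritten k false s ∧ MarkProgram.CoversWritten k true s)
    refine ⟨MarkProgram.CoverMark k, inferInstance, prog, T, fun I =>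
      MarkProgram.machine_outputs ?_⟩
    have : checkId (TriBoolMatrix (k + 1)) I =
        decide (MarkProgram.CoversWritten k false (encodeIdentity I) ∧
          MarkProgram.CoversWritten k true (encodeIdentity I)) := by
      have h1 := MarkProgram.coversWritten_iff k (wordLetters I.lhs) (wordLetters I.rhs)
      rw [checkId, decide_eq_decide, holdsIn_succ_iff]
      exact (and_congr h1.1 h1.2).symm
    rw [this]
    exact h _

/-- Since `x < 2 ^ x`, an index `x` has at most `x` binary digits. This crude bound, plus one end
mark per variable, suffices. -/
theorem length_encodeLetters_le {l : List ℕ} {m : ℕ} (h : ∀ x ∈ l, x < m) :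
    (encodeLetters l).length ≤ l.length * (m + 1) := by
  induction l with
  | nil => simp [encodeLetters]
  | cons x l ih =>
    have h1 := ih fun y hy => h y (List.mem_cons_of_mem _ hy)
    have h2 : x.bits.length ≤ m := by
      rw [Nat.size_eq_bits_len]
      exact (Nat.size_le.2 Nat.lt_two_pow_self).trans (h x List.mem_cons_self).le
    rw [encodeLetters_cons, List.length_append, List.length_map, List.length_cons,
      List.length_cons, Nat.succ_mul]
    omega

theorem length_encodeIdentity_le {I : SemigroupIdentity} (h : I.IsNormalized) :
    (encodeIdentity I).length ≤ I.size * (I.size + 1) + 1 := by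
  have h1 := length_encodeLetters_le fun x hx => h x (List.mem_append_left _ hx)
  have h2 := length_encodeLetters_le fun x hx => h x (List.mem_append_right _ hx)
  have hl : ∀ w : FreeSemigroup ℕ, (wordLetters w).length = w.length := fun _ => rfl
  have h3 : (encodeIdentity I).length = (encodeLetters (wordLetters I.lhs)).length +
      ((encodeLetters (wordLetters I.rhs)).length + 1) := by
    rw [encodeIdentity, List.length_append, List.length_cons]
    rfl
  have h4 : I.size * (I.size + 1) = I.lhs.length * (I.size + 1) + I.rhs.length * (I.size + 1) :=
    Nat.add_mul _ _ _
  rw [hl] at h1 h2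
  omega

theorem Polynomial.eval_le_eval_of_le (p : Polynomial ℕ) {a b : ℕ} (h : a ≤ b) :
    p.eval a ≤ p.eval b := by
  rw [Polynomial.eval_eq_sum_range, Polynomial.eval_eq_sum_range]
  gcongr

theorem mainTheorem9 (n : ℕ) :
    ∃ (M : Turing.TM2ComputableInPolyTime encodeIdentity Computability.encodeBool
        (checkId (TriBoolMatrix n))) (q : Polynomial ℕ),
      ∀ I : SemigroupIdentity, I.IsNormalized →
        Nonempty (Turing.TM2OutputsInTime M.tm
          (List.map M.inputAlphabet.invFun (encodeIdentity I))
          (some (List.map M.outputAlphabet.invFun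
            (Computability.encodeBool (checkId (TriBoolMatrix n) I))))
          (q.eval I.size)) := by
  obtain ⟨ι, _, prog, T, h⟩ := exists_machine n
  have h' : ∀ I : SemigroupIdentity, Nonempty (Turing.TM2OutputsInTime (MarkProgram.machine prog)
      (List.map (Equiv.refl InputSymbol).invFun (encodeIdentity I))
      (some (List.map (Equiv.refl Bool).invFun
        (Computability.encodeBool (checkId (TriBoolMatrix n) I))))
      (T.eval (encodeIdentity I).length)) := by
    intro I
    have hmap : List.map (Equiv.refl InputSymbol).invFun (encodeIdentity I) = encodeIdentity I :=
      List.map_id _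
    exact (congrArg (fun w : List InputSymbol => Nonempty (Turing.TM2OutputsInTime
      (MarkProgram.machine prog) w (some [checkId (TriBoolMatrix n) I])
      (T.eval (encodeIdentity I).length))) hmap).mpr (h I)
  refine ⟨{ tm := MarkProgram.machine prog
            inputAlphabet := Equiv.refl InputSymbol
            outputAlphabet := Equiv.refl Bool
            time := T
            outputsFun := fun I => (h' I).some },
    -- Coefficients are natural numbers, so `T` is monotone, and the bound on the input length may
    -- be substituted into it.
    T.comp (Polynomial.X * (Polynomial.X + 1) + 1), fun I hI => ?_⟩
  obtain ⟨r⟩ := h' I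
  refine ⟨⟨r.toEvalsTo, r.steps_le_m.trans ?_⟩⟩
  rw [Polynomial.eval_comp]
  exact T.eval_le_eval_of_le (by simpa using length_encodeIdentity_le hI)
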